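/- For integers $X,H,y>1$ (with $p$ denoting primes) let $\alpha_y(n)=1$ if every prime dividing $n$ is $>y$ and $\alpha_y(n)=0$ otherwise, let $P_y=\prod_{p\le y}(1-1/p)$, and define \[ V(X,H,y)=\frac1X\int_0^X\Bigl(\sum_{x<n\le x+H}\alpha_y(n)-HP_y\Bigr)^2dx, \] \[ M(H,y)=\prod_{2<p\le y}\Bigl(1-\frac2p\Bigr)\sum_{n\ge1}g_y(n)\Bigl\{\frac{H}{2n}\Bigr\}\Bigl(1-\Bigl\{\frac{H}{2n}\Bigr\}\Bigr), \] where $\{t\}$ is the fractional part of $t$ and $g_y$ is the multiplicative function supported on squarefree integers with $g_y(p)=p/(p-2)$ if $2<p\le y$ and $g_y(p)=0$ for all other primes $p$. Theorem. Fix $\varepsilon>0$ and $\delta>0$. Suppose that integers $y,H,X$ with $1<y\le X$ and $1<H\le X$ tend to infinity in such a way that $y\ge(\log H)^{1+\varepsilon}$ and, with $a=\log\log H/\log y$, \[ (1+a)\frac{\log H}{\log\log H}\le(1-\delta)\frac{\log X}{\log y}. \] Then $V(X,H,y)\sim M(H,y)$. -/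

import Mathlib

open Filter Asymptotics

noncomputable section

namespace RoughVariance

open Classical in
/-- The indicator function `α_y` of the integers all of whose prime factors exceed `y`. -/
def roughInd (y n : ℕ) : ℝ :=
  if ∀ p : ℕ, p.Prime → p ∣ n → y < p then 1 else 0

/-- The density `∏_{p ≤ y} (1 - 1/p)` of the integers without prime factors up to `y`. -/
def roughDensity (y : ℕ) : ℝ :=
  ∏ p ∈ (Finset.Icc 1 y).filter Nat.Prime, (1 - 1 / (p : ℝ))

/-- The number of `y`-rough integers `n` with `x < n ≤ x + H`, for real `x ≥ 0`. -/
def roughCount (H y : ℕ) (x : ℝ) : ℝ :=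
  ∑ n ∈ Finset.Ioc ⌊x⌋₊ ⌊x + (H : ℝ)⌋₊, roughInd y n

/-- The variance `V(X, H, y)` of the count of `y`-rough integers in intervals `(x, x + H]`. -/
def V (X H y : ℕ) : ℝ :=
  1 / (X : ℝ) * ∫ x in (0 : ℝ)..(X : ℝ), (roughCount H y x - (H : ℝ) * roughDensity y) ^ 2

/-- The values of `g_y` at primes. -/
def gPrime (y p : ℕ) : ℝ :=
  if 2 < p ∧ p ≤ y then (p : ℝ) / ((p : ℝ) - 2) else 0

/-- The multiplicative function `g_y`, supported on squarefree integers, with the values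
`gPrime y p` at primes `p`. -/
def g (y n : ℕ) : ℝ :=
  if Squarefree n then ∏ p ∈ n.primeFactors, gPrime y p else 0

/-- The main term `M(H, y)`. The term `n = 0` of the series vanishes, since `g y 0 = 0`, and
only finitely many terms are non-zero. -/
def M (H y : ℕ) : ℝ :=
  (∏ p ∈ (Finset.Icc 3 y).filter Nat.Prime, (1 - 2 / (p : ℝ))) *
    ∑' n : ℕ, g y n * Int.fract ((H : ℝ) / (2 * (n : ℝ))) *
      (1 - Int.fract ((H : ℝ) / (2 * (n : ℝ))))

theorem g_zero (y : ℕ) : g y 0 = 0 := by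
  simp [g]

/-- The function `g_y` has finite support. -/
theorem finite_support_g (y : ℕ) : (Function.support (g y)).Finite := by
  refine (Set.finite_Iic (primorial y)).subset fun n hn => ?_
  have hsq : Squarefree n := by
    by_contra h
    exact hn (by simp [g, h])
  have hp : ∏ p ∈ n.primeFactors, gPrime y p ≠ 0 := by
    intro h
    exact hn (by simp [g, h])
  have hle : ∀ p ∈ n.primeFactors, p ≤ y := by
    intro p hpn
    by_contra hy
    exact (Finset.prod_ne_zero_iff.mp hp p hpn) (by simp [gPrime, hy])
  have hsub : n.primeFactors ⊆ (Finset.range (y + 1)).filter Nat.Prime := by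
    intro p hpn
    simp only [Finset.mem_filter, Finset.mem_range]
    exact ⟨Nat.lt_succ_of_le (hle p hpn), Nat.prime_of_mem_primeFactors hpn⟩
  have hdvd : n ∣ primorial y := by
    rw [← Nat.prod_primeFactors_of_squarefree hsq]
    exact Finset.prod_dvd_prod_of_subset _ _ _ hsub
  exact Nat.le_of_dvd (primorial_pos y) hdvd

end RoughVariance

end

/-!
Expanding the square writes `V X H y` as a sum over pairs `i, j < H` of densities of the `m < X`
for which `m + i` and `m + j` have no prime factor up to `y`. Replacing each density by its
heuristic value `∏ p ≤ y, (1 - ν p / p)`, where `ν p` is the number of residue classes modulo `p`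
that are sieved out, gives `M H y` exactly. The Brun-Hooley sieve controls the error: the primes
up to `y` are cut into blocks on which `log y / log p` is constant up to a factor `k + 4`, and
inclusion-exclusion on the block of index `l` is truncated after `k * 2 ^ l` primes. If
`y ^ (k + 20) ≤ X`, the relative error is `k ^ (-(1 + o(1)) * k)`, which for `k` slightly larger
than `(1 + a) * log H / log log H` is at most `H ^ (-(1 + a + δ / 4))`.

As the error is relative to the density `P` of the `y`-rough integers, the error in `V X H y` is at
most `P * H ^ (1 - a - δ / 4)`. It remains to see that `M H y` is at least `P * H ^ (1 - a - o(1))`,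
for which the terms of the series over products `n ≥ H` of odd primes up to `y` suffice. If
`y ≤ H ^ 2`, take products of about `log H / log y` primes from `(y ^ (1 - o(1)), y]`; otherwise,
multiples of a prime from `(H, H ^ 2]`.
-/

noncomputable section

namespace RoughVariance

open Finset
open scoped Nat

section TruncatedInclusionExclusion

variable {α : Type*} {s : Finset α} {x : α → ℝ}

/-- The sum of `c #S * ∏ p ∈ S, x p` over the subsets `S` of `s`. Different coefficients `c` give
the elementary symmetric functions of the `x p` and the truncations of inclusion-exclusion. -/
def weightedSum (c : ℕ → ℝ) (s : Finset α) (x : α → ℝ) : ℝ :=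
  ∑ S ∈ s.powerset, c #S * ∏ p ∈ S, x p

/-- The coefficients of inclusion-exclusion truncated after the subsets of size `k`, as in Brun's
pure sieve. -/
def brunCoef (k i : ℕ) : ℝ := if i ≤ k then (-1) ^ i else 0

/-- The coefficients of the elementary symmetric function of degree `k`. -/
def esymmCoef (k i : ℕ) : ℝ := if i = k then 1 else 0

/-- The indicator function of `i ≤ k`, which dominates `|brunCoef k|` and `|esymmCoef k|`. -/
def truncCoef (k i : ℕ) : ℝ := if i ≤ k then 1 else 0

theorem brunCoef_succ (k i : ℕ) :
    brunCoef (k + 1) i = brunCoef k i + (-1) ^ (k + 1) * esymmCoef (k + 1) i := by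
  unfold brunCoef esymmCoef
  split_ifs <;> first | omega | simp_all

theorem brunCoef_succ_succ (k i : ℕ) : brunCoef (k + 1) (i + 1) = -brunCoef k i := by
  simp only [brunCoef, add_le_add_iff_right, pow_succ]
  split_ifs <;> ring

theorem esymmCoef_succ_succ (k i : ℕ) : esymmCoef (k + 1) (i + 1) = esymmCoef k i := by
  simp [esymmCoef]

theorem truncCoef_succ_succ (k i : ℕ) : truncCoef (k + 1) (i + 1) = truncCoef k i := by
  simp [truncCoef]

theorem truncCoef_eq_sum_esymmCoef (k i : ℕ) :
    truncCoef k i = ∑ d ∈ range (k + 1), esymmCoef d i := by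
  simp [truncCoef, esymmCoef]

theorem abs_brunCoef_le (k i : ℕ) : |brunCoef k i| ≤ truncCoef (k + 1) i := by
  unfold brunCoef truncCoef
  split_ifs <;> first | omega | simp

theorem abs_esymmCoef_le (k i : ℕ) : |esymmCoef k i| ≤ truncCoef k i := by
  unfold esymmCoef truncCoef
  split_ifs <;> first | omega | simp

theorem weightedSum_empty (c : ℕ → ℝ) (x : α → ℝ) : weightedSum c ∅ x = c 0 := by
  simp [weightedSum]

theorem weightedSum_insert [DecidableEq α] (c : ℕ → ℝ) {a : α} (ha : a ∉ s) (x : α → ℝ) :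
    weightedSum c (insert a s) x =
      weightedSum c s x + x a * weightedSum (fun i => c (i + 1)) s x := by
  unfold weightedSum
  rw [sum_powerset_insert ha, mul_sum]
  congr 1
  refine sum_congr rfl fun S hS => ?_
  have haS : a ∉ S := fun h => ha (mem_powerset.mp hS h)
  rw [card_insert_of_notMem haS, prod_insert haS]
  ring

theorem weightedSum_zero (s : Finset α) (x : α → ℝ) : weightedSum (fun _ => 0) s x = 0 := by
  simp [weightedSum]

theorem weightedSum_neg (c : ℕ → ℝ) (s : Finset α) (x : α → ℝ) :
    weightedSum (fun i => -c i) s x = -weightedSum c s x := by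
  simp [weightedSum]

theorem weightedSum_add_mul (c d : ℕ → ℝ) (t : ℝ) (s : Finset α) (x : α → ℝ) :
    weightedSum (fun i => c i + t * d i) s x = weightedSum c s x + t * weightedSum d s x := by
  simp only [weightedSum, mul_sum, ← sum_add_distrib]
  exact sum_congr rfl fun S _ => by ring

theorem weightedSum_finset_sum {ι : Type*} (I : Finset ι) (c : ι → ℕ → ℝ) (s : Finset α)
    (x : α → ℝ) : weightedSum (fun i => ∑ d ∈ I, c d i) s x = ∑ d ∈ I, weightedSum (c d) s x := by
  simp only [weightedSum, sum_mul]
  exact sum_comm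

theorem weightedSum_mono {c c' : ℕ → ℝ} (h : ∀ i, c i ≤ c' i) (hx : ∀ p ∈ s, 0 ≤ x p) :
    weightedSum c s x ≤ weightedSum c' s x :=
  sum_le_sum fun _ hS => mul_le_mul_of_nonneg_right (h _)
    (prod_nonneg fun p hp => hx p (mem_powerset.mp hS hp))

theorem weightedSum_nonneg {c : ℕ → ℝ} (h : ∀ i, 0 ≤ c i) (hx : ∀ p ∈ s, 0 ≤ x p) :
    0 ≤ weightedSum c s x :=
  (weightedSum_zero s x).ge.trans (weightedSum_mono h hx)

theorem weightedSum_brunCoef_succ (k : ℕ) (s : Finset α) (x : α → ℝ) :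
    weightedSum (brunCoef (k + 1)) s x =
      weightedSum (brunCoef k) s x + (-1) ^ (k + 1) * weightedSum (esymmCoef (k + 1)) s x := by
  rw [← weightedSum_add_mul]
  exact congrArg (weightedSum · s x) (funext (brunCoef_succ k))

theorem weightedSum_brunCoef_zero (s : Finset α) (x : α → ℝ) :
    weightedSum (brunCoef 0) s x = 1 := by
  classical
  induction s using Finset.induction_on with
  | empty => simp [weightedSum_empty, brunCoef]
  | insert a s ha ih => simp [weightedSum_insert _ ha, ih, brunCoef, weightedSum_zero]

theorem weightedSum_esymmCoef_zero (s : Finset α) (x : α → ℝ) :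
    weightedSum (esymmCoef 0) s x = 1 := by
  classical
  induction s using Finset.induction_on with
  | empty => simp [weightedSum_empty, esymmCoef]
  | insert a s ha ih => simp [weightedSum_insert _ ha, ih, esymmCoef, weightedSum_zero]

theorem weightedSum_brunCoef_succ_insert [DecidableEq α] (k : ℕ) {a : α} (ha : a ∉ s)
    (x : α → ℝ) : weightedSum (brunCoef (k + 1)) (insert a s) x =
      weightedSum (brunCoef (k + 1)) s x - x a * weightedSum (brunCoef k) s x := by
  simp only [weightedSum_insert _ ha, brunCoef_succ_succ, weightedSum_neg]
  ring

theorem weightedSum_esymmCoef_succ_insert [DecidableEq α] (k : ℕ) {a : α} (ha : a ∉ s)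
    (x : α → ℝ) : weightedSum (esymmCoef (k + 1)) (insert a s) x =
      weightedSum (esymmCoef (k + 1)) s x + x a * weightedSum (esymmCoef k) s x := by
  simp only [weightedSum_insert _ ha, esymmCoef_succ_succ]

theorem pow_succ_add_mul_pow_le_add_pow {a b : ℝ} (ha : 0 ≤ a) (hb : 0 ≤ b) (k : ℕ) :
    b ^ (k + 1) + (k + 1) * (a * b ^ k) ≤ (a + b) ^ (k + 1) := by
  induction k with
  | zero => simp [add_comm]
  | succ k ih =>
    have hsq : 0 ≤ (k + 1) * (a * (a * b ^ k)) := by positivity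
    calc b ^ (k + 1 + 1) + ((k + 1 : ℕ) + 1) * (a * b ^ (k + 1))
        ≤ (b ^ (k + 1) + (k + 1) * (a * b ^ k)) * (a + b) := by push_cast; linear_combination hsq
      _ ≤ (a + b) ^ (k + 1) * (a + b) := by gcongr
      _ = (a + b) ^ (k + 1 + 1) := (pow_succ _ _).symm

theorem weightedSum_esymmCoef_le (k : ℕ) (hx : ∀ p ∈ s, 0 ≤ x p) :
    weightedSum (esymmCoef k) s x ≤ (∑ p ∈ s, x p) ^ k / k ! := by
  classical
  induction s using Finset.induction_on generalizing k with
  | empty => rcases k with _ | k <;> simp [weightedSum_empty, esymmCoef]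
  | insert a s ha ih =>
    obtain ⟨hxa, hxs⟩ := forall_mem_insert .. |>.mp hx
    rcases k with _ | k
    · simp [weightedSum_esymmCoef_zero]
    rw [weightedSum_esymmCoef_succ_insert k ha, sum_insert ha]
    have hσ : 0 ≤ ∑ p ∈ s, x p := sum_nonneg hxs
    set σ := ∑ p ∈ s, x p
    calc weightedSum (esymmCoef (k + 1)) s x + x a * weightedSum (esymmCoef k) s x
        ≤ σ ^ (k + 1) / (k + 1)! + x a * (σ ^ k / k !) := by gcongr <;> exact ih _ hxs
      _ = (σ ^ (k + 1) + (k + 1) * (x a * σ ^ k)) / (k + 1)! := by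
          rw [Nat.factorial_succ]; push_cast; field_simp
      _ ≤ (x a + σ) ^ (k + 1) / (k + 1)! := by
          gcongr; exact pow_succ_add_mul_pow_le_add_pow hxa hσ k

theorem weightedSum_truncCoef_le_pow (k : ℕ) (hx : ∀ p ∈ s, 0 ≤ x p) :
    weightedSum (truncCoef k) s x ≤ (1 + ∑ p ∈ s, x p) ^ k := by
  classical
  induction s using Finset.induction_on generalizing k with
  | empty => simp [weightedSum_empty, truncCoef]
  | insert a s ha ih =>
    obtain ⟨hxa, hxs⟩ := forall_mem_insert .. |>.mp hx
    have hσ : 0 ≤ ∑ p ∈ s, x p := sum_nonneg hxs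
    rw [weightedSum_insert _ ha, sum_insert ha]
    rcases k with _ | k
    · simpa [truncCoef, weightedSum_zero] using ih 0 hxs
    simp only [truncCoef_succ_succ]
    set σ := ∑ p ∈ s, x p
    calc weightedSum (truncCoef (k + 1)) s x + x a * weightedSum (truncCoef k) s x
        ≤ (1 + σ) ^ (k + 1) + x a * (1 + σ) ^ k := by gcongr <;> exact ih _ hxs
      _ = (1 + (x a + σ)) * (1 + σ) ^ k := by ring
      _ ≤ (1 + (x a + σ)) * (1 + (x a + σ)) ^ k := by gcongr; linarith
      _ = (1 + (x a + σ)) ^ (k + 1) := (pow_succ' _ _).symm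

theorem pow_div_factorial_le_of_le {A : ℝ} {i k : ℕ} (hik : i ≤ k) (hkA : k ≤ A) :
    A ^ i / i ! ≤ A ^ k / k ! := by
  induction k, hik using Nat.le_induction with
  | base => exact le_rfl
  | succ k _ ih =>
    push_cast at hkA
    have hA : 0 ≤ A := by linarith [(k.cast_nonneg : (0 : ℝ) ≤ k)]
    calc A ^ i / i ! ≤ A ^ k / k ! := ih (by linarith)
      _ ≤ A ^ k / k ! * (A / (k + 1)) :=
          le_mul_of_one_le_right (by positivity) ((one_le_div (by positivity)).mpr hkA)
      _ = A ^ (k + 1) / (k + 1)! := by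
          rw [Nat.factorial_succ, pow_succ]; push_cast; field_simp

theorem weightedSum_truncCoef_le {k : ℕ} {A : ℝ} (hx : ∀ p ∈ s, 0 ≤ x p) (hA : ∑ p ∈ s, x p ≤ A)
    (hkA : k ≤ A) : weightedSum (truncCoef k) s x ≤ (k + 1) * (A ^ k / k !) := by
  rw [funext (truncCoef_eq_sum_esymmCoef k), weightedSum_finset_sum]
  have hterm : ∀ i ∈ range (k + 1), weightedSum (esymmCoef i) s x ≤ A ^ k / k ! := fun i hi =>
    calc weightedSum (esymmCoef i) s x ≤ (∑ p ∈ s, x p) ^ i / i ! := weightedSum_esymmCoef_le i hx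
      _ ≤ A ^ i / i ! := by
          have := sum_nonneg hx
          gcongr
      _ ≤ A ^ k / k ! := pow_div_factorial_le_of_le (mem_range_succ_iff.mp hi) hkA
  simpa using sum_le_card_nsmul _ _ _ hterm

theorem bonferroni (k : ℕ) (h0 : ∀ p ∈ s, 0 ≤ x p) (h1 : ∀ p ∈ s, x p ≤ 1) :
    0 ≤ (-1) ^ k * (weightedSum (brunCoef k) s x - ∏ p ∈ s, (1 - x p)) := by
  classical
  induction s using Finset.induction_on generalizing k with
  | empty => simp [weightedSum_empty, brunCoef]
  | insert a s ha ih =>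
    obtain ⟨h0a, h0s⟩ := forall_mem_insert .. |>.mp h0
    rcases k with _ | k
    · have : ∏ p ∈ insert a s, (1 - x p) ≤ 1 := prod_le_one
        (fun p hp => sub_nonneg.mpr (h1 p hp)) fun p hp => sub_le_self _ (h0 p hp)
      simpa [weightedSum_brunCoef_zero] using this
    have h1s : ∀ p ∈ s, x p ≤ 1 := fun p hp => h1 p (mem_insert_of_mem hp)
    rw [prod_insert ha, weightedSum_brunCoef_succ_insert k ha]
    linear_combination ih (k + 1) h0s h1s + x a * ih k h0s h1s

theorem prod_one_sub_le_weightedSum_brunCoef {k : ℕ} (hk : Even k) (h0 : ∀ p ∈ s, 0 ≤ x p)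
    (h1 : ∀ p ∈ s, x p ≤ 1) : ∏ p ∈ s, (1 - x p) ≤ weightedSum (brunCoef k) s x := by
  simpa [hk.neg_one_pow] using bonferroni k h0 h1

theorem weightedSum_brunCoef_sub_prod_one_sub_le {k : ℕ} (hk : Even k) (h0 : ∀ p ∈ s, 0 ≤ x p)
    (h1 : ∀ p ∈ s, x p ≤ 1) :
    weightedSum (brunCoef k) s x - ∏ p ∈ s, (1 - x p) ≤ weightedSum (esymmCoef (k + 1)) s x := by
  have h := bonferroni (k + 1) h0 h1
  rw [weightedSum_brunCoef_succ, hk.add_one.neg_one_pow] at h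
  linarith

end TruncatedInclusionExclusion

section BrunHooley

variable {ι α β : Type*}

theorem prod_sub_prod_le_sum_prod_ite [DecidableEq ι] (s : Finset ι) {f g h : ι → ℝ}
    (hf : ∀ j ∈ s, 0 ≤ f j) (hfg : ∀ j ∈ s, f j ≤ g j) (hgh : ∀ j ∈ s, g j - f j ≤ h j) :
    ∏ j ∈ s, g j - ∏ j ∈ s, f j ≤ ∑ l ∈ s, ∏ j ∈ s, if j = l then h j else g j := by
  induction s using Finset.induction_on with
  | empty => simp
  | insert a s ha ih =>
    obtain ⟨hfa, hfs⟩ := forall_mem_insert .. |>.mp hf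
    obtain ⟨hfga, hfgs⟩ := forall_mem_insert .. |>.mp hfg
    obtain ⟨hgha, hghs⟩ := forall_mem_insert .. |>.mp hgh
    have hne : ∀ j ∈ s, j ≠ a := fun j hj => ne_of_mem_of_not_mem hj ha
    have hdiag : ∏ j ∈ s, (if j = a then h j else g j) = ∏ j ∈ s, g j :=
      prod_congr rfl fun j hj => if_neg (hne j hj)
    have hoff : ∑ l ∈ s, ∏ j ∈ insert a s, (if j = l then h j else g j) =
        g a * ∑ l ∈ s, ∏ j ∈ s, (if j = l then h j else g j) := by
      rw [mul_sum]
      exact sum_congr rfl fun l hl => by rw [prod_insert ha, if_neg (hne l hl).symm]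
    rw [prod_insert ha, prod_insert ha, sum_insert ha, prod_insert ha, if_pos rfl, hdiag, hoff]
    calc g a * ∏ j ∈ s, g j - f a * ∏ j ∈ s, f j
        = (g a - f a) * ∏ j ∈ s, f j + g a * (∏ j ∈ s, g j - ∏ j ∈ s, f j) := by ring
      _ ≤ h a * ∏ j ∈ s, g j + g a * ∑ l ∈ s, ∏ j ∈ s, if j = l then h j else g j := by
          exact add_le_add
            (mul_le_mul hgha (prod_le_prod hfs hfgs) (prod_nonneg hfs)
              ((sub_nonneg.mpr hfga).trans hgha))
            (mul_le_mul_of_nonneg_left (ih hfs hfgs hghs) (hfa.trans hfga))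

variable [Fintype ι]

theorem sum_prod_ite_le_prod_mul_exp [DecidableEq ι] {f g h θ : ι → ℝ} (hf : ∀ l, 0 ≤ f l)
    (hfg : ∀ l, f l ≤ g l) (hgh : ∀ l, g l - f l ≤ h l) (hθ : ∀ l, 0 ≤ θ l)
    (hhf : ∀ l, h l ≤ θ l * f l) :
    ∑ l, ∏ t, (if t = l then h t else g t) ≤ (∏ t, f t) * ((∑ t, θ t) * Real.exp (∑ t, θ t)) := by
  have hfactor (l t : ι) :
      (if t = l then h t else g t) ≤ (if t = l then θ t else 1) * (f t * Real.exp (θ t)) := by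
    have hexp : 1 + θ t ≤ Real.exp (θ t) := by linarith [Real.add_one_le_exp (θ t)]
    split_ifs
    · exact (hhf t).trans (mul_le_mul_of_nonneg_left
        (le_mul_of_one_le_right (hf t) (by linarith [hθ t])) (hθ t))
    · calc g t ≤ f t * (1 + θ t) := by linarith [hgh t, hhf t]
        _ ≤ 1 * (f t * Real.exp (θ t)) := by
            rw [one_mul]; exact mul_le_mul_of_nonneg_left hexp (hf t)
  have hfactor0 (l t : ι) : 0 ≤ if t = l then h t else g t := by
    split_ifs
    · exact (sub_nonneg.mpr (hfg t)).trans (hgh t)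
    · exact (hf t).trans (hfg t)
  calc ∑ l, ∏ t, (if t = l then h t else g t)
      ≤ ∑ l, ∏ t, (if t = l then θ t else 1) * (f t * Real.exp (θ t)) :=
        sum_le_sum fun l _ => prod_le_prod (fun t _ => hfactor0 l t) fun t _ => hfactor l t
    _ = ∑ l, θ l * ((∏ t, f t) * Real.exp (∑ t, θ t)) := by
        simp only [prod_mul_distrib, prod_ite_eq', mem_univ, if_true, Real.exp_sum]
    _ = (∏ t, f t) * ((∑ t, θ t) * Real.exp (∑ t, θ t)) := by
        rw [← sum_mul]; ring

theorem prod_weightedSum [DecidableEq ι] [DecidableEq α] (c : ι → ℕ → ℝ) {s : ι → Finset α}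
    (hs : Pairwise (Function.onFun Disjoint s)) (x : α → ℝ) :
    ∏ l, weightedSum (c l) (s l) x =
      ∑ F ∈ Fintype.piFinset fun l => (s l).powerset,
        (∏ l, c l #(F l)) * ∏ p ∈ univ.biUnion F, x p := by
  unfold weightedSum
  rw [prod_univ_sum]
  refine sum_congr rfl fun F hF => ?_
  have hFs l : F l ⊆ s l := mem_powerset.mp (Fintype.mem_piFinset.mp hF l)
  rw [prod_mul_distrib, prod_biUnion]
  exact fun i _ j _ hij => (hs hij).mono (hFs i) (hFs j)

theorem abs_sum_prod_weightedSum_sub_le [DecidableEq α] (c : ι → ℕ → ℝ) {s : ι → Finset α}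
    (hs : Pairwise (Function.onFun Disjoint s)) (A : Finset β) (b : β → α → ℝ) (ρ : α → ℝ)
    (N C : ℝ) (hb : ∀ S ⊆ univ.biUnion s,
      |∑ m ∈ A, ∏ p ∈ S, b m p - N * ∏ p ∈ S, ρ p| ≤ C ^ #S) :
    |∑ m ∈ A, ∏ l, weightedSum (c l) (s l) (b m) - N * ∏ l, weightedSum (c l) (s l) ρ| ≤
      ∏ l, weightedSum (fun i => |c l i|) (s l) fun _ => C := by
  classical
  simp_rw [prod_weightedSum _ hs]
  rw [sum_comm, mul_sum, ← sum_sub_distrib]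
  refine (abs_sum_le_sum_abs _ _).trans (sum_le_sum fun F hF => ?_)
  rw [← mul_sum, mul_left_comm N, ← mul_sub, abs_mul, abs_prod, prod_const]
  refine mul_le_mul_of_nonneg_left (hb _ ?_) (prod_nonneg fun l _ => abs_nonneg _)
  exact biUnion_mono fun l _ => mem_powerset.mp (Fintype.mem_piFinset.mp hF l)

/-- The upper bound for `∏ l, ∏ p ∈ s l, (1 - x p)` in the Brun-Hooley sieve: inclusion-exclusion on
the block `s l` is truncated after `k l` factors. -/
def hooleyUpper (k : ι → ℕ) (s : ι → Finset α) (x : α → ℝ) : ℝ :=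
  ∏ l, weightedSum (brunCoef (k l)) (s l) x

/-- The bound for `hooleyUpper k s x - ∏ l, ∏ p ∈ s l, (1 - x p)` in the Brun-Hooley sieve: in turn,
each block is replaced by the bound for its truncation error. -/
def hooleyError [DecidableEq ι] (k : ι → ℕ) (s : ι → Finset α) (x : α → ℝ) : ℝ :=
  ∑ l, ∏ t, weightedSum (if t = l then esymmCoef (k t + 1) else brunCoef (k t)) (s t) x

variable {k : ι → ℕ} {s : ι → Finset α} {x : α → ℝ}

theorem prod_prod_one_sub_le_hooleyUpper (hk : ∀ l, Even (k l)) (h0 : ∀ l, ∀ p ∈ s l, 0 ≤ x p)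
    (h1 : ∀ l, ∀ p ∈ s l, x p ≤ 1) : ∏ l, ∏ p ∈ s l, (1 - x p) ≤ hooleyUpper k s x :=
  prod_le_prod (fun l _ => prod_nonneg fun p hp => sub_nonneg.mpr (h1 l p hp))
    fun l _ => prod_one_sub_le_weightedSum_brunCoef (hk l) (h0 l) (h1 l)

theorem hooleyError_eq_sum_prod_ite [DecidableEq ι] (k : ι → ℕ) (s : ι → Finset α) (x : α → ℝ) :
    hooleyError k s x = ∑ l, ∏ t, if t = l then weightedSum (esymmCoef (k t + 1)) (s t) x
      else weightedSum (brunCoef (k t)) (s t) x :=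
  sum_congr rfl fun l _ => prod_congr rfl fun t _ => by split_ifs <;> rfl

theorem hooleyUpper_sub_le_hooleyError [DecidableEq ι] (hk : ∀ l, Even (k l))
    (h0 : ∀ l, ∀ p ∈ s l, 0 ≤ x p) (h1 : ∀ l, ∀ p ∈ s l, x p ≤ 1) :
    hooleyUpper k s x - ∏ l, ∏ p ∈ s l, (1 - x p) ≤ hooleyError k s x := by
  rw [hooleyError_eq_sum_prod_ite]
  exact prod_sub_prod_le_sum_prod_ite univ
    (fun l _ => prod_nonneg fun p hp => sub_nonneg.mpr (h1 l p hp))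
    (fun l _ => prod_one_sub_le_weightedSum_brunCoef (hk l) (h0 l) (h1 l))
    fun l _ => weightedSum_brunCoef_sub_prod_one_sub_le (hk l) (h0 l) (h1 l)

theorem hooleyError_le [DecidableEq ι] (hk : ∀ l, Even (k l)) (h0 : ∀ l, ∀ p ∈ s l, 0 ≤ x p)
    (h1 : ∀ l, ∀ p ∈ s l, x p ≤ 1) {θ : ι → ℝ} (hθ0 : ∀ l, 0 ≤ θ l)
    (hθ : ∀ l, weightedSum (esymmCoef (k l + 1)) (s l) x ≤ θ l * ∏ p ∈ s l, (1 - x p)) :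
    hooleyError k s x ≤
      (∏ l, ∏ p ∈ s l, (1 - x p)) * ((∑ l, θ l) * Real.exp (∑ l, θ l)) := by
  rw [hooleyError_eq_sum_prod_ite]
  exact sum_prod_ite_le_prod_mul_exp
    (fun l => prod_nonneg fun p hp => sub_nonneg.mpr (h1 l p hp))
    (fun l => prod_one_sub_le_weightedSum_brunCoef (hk l) (h0 l) (h1 l))
    (fun l => weightedSum_brunCoef_sub_prod_one_sub_le (hk l) (h0 l) (h1 l)) hθ0 hθ

section Remainder

variable [DecidableEq α] {A : Finset β} {b : β → α → ℝ} {ρ : α → ℝ} {N C R : ℝ}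

theorem abs_sum_prod_weightedSum_sub_le_of_abs_le (hs : Pairwise (Function.onFun Disjoint s))
    (hC : 0 ≤ C)
    (hb : ∀ S ⊆ univ.biUnion s, |∑ m ∈ A, ∏ p ∈ S, b m p - N * ∏ p ∈ S, ρ p| ≤ C ^ #S)
    (hR : ∏ l, weightedSum (truncCoef (k l + 1)) (s l) (fun _ => C) ≤ R) {c : ι → ℕ → ℝ}
    (hc : ∀ l i, |c l i| ≤ truncCoef (k l + 1) i) :
    |∑ m ∈ A, ∏ l, weightedSum (c l) (s l) (b m) - N * ∏ l, weightedSum (c l) (s l) ρ| ≤ R :=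
  calc _ ≤ ∏ l, weightedSum (fun i => |c l i|) (s l) fun _ => C :=
        abs_sum_prod_weightedSum_sub_le c hs A b ρ N C hb
    _ ≤ ∏ l, weightedSum (truncCoef (k l + 1)) (s l) fun _ => C :=
        prod_le_prod (fun _ _ => weightedSum_nonneg (fun _ => abs_nonneg _) fun _ _ => hC)
          fun l _ => weightedSum_mono (hc l) fun _ _ => hC
    _ ≤ R := hR

theorem abs_sum_hooleyUpper_sub_le (hs : Pairwise (Function.onFun Disjoint s)) (hC : 0 ≤ C)
    (hb : ∀ S ⊆ univ.biUnion s, |∑ m ∈ A, ∏ p ∈ S, b m p - N * ∏ p ∈ S, ρ p| ≤ C ^ #S)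
    (hR : ∏ l, weightedSum (truncCoef (k l + 1)) (s l) (fun _ => C) ≤ R) :
    |∑ m ∈ A, hooleyUpper k s (b m) - N * hooleyUpper k s ρ| ≤ R :=
  abs_sum_prod_weightedSum_sub_le_of_abs_le hs hC hb hR fun _ _ => abs_brunCoef_le _ _

theorem abs_sum_hooleyError_sub_le [DecidableEq ι] (hs : Pairwise (Function.onFun Disjoint s))
    (hC : 0 ≤ C)
    (hb : ∀ S ⊆ univ.biUnion s, |∑ m ∈ A, ∏ p ∈ S, b m p - N * ∏ p ∈ S, ρ p| ≤ C ^ #S)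
    (hR : ∏ l, weightedSum (truncCoef (k l + 1)) (s l) (fun _ => C) ≤ R) :
    |∑ m ∈ A, hooleyError k s (b m) - N * hooleyError k s ρ| ≤ Fintype.card ι * R := by
  unfold hooleyError
  rw [sum_comm, mul_sum, ← sum_sub_distrib, ← nsmul_eq_mul]
  refine (abs_sum_le_sum_abs _ _).trans (sum_le_card_nsmul univ _ _ fun l _ => ?_)
  refine abs_sum_prod_weightedSum_sub_le_of_abs_le hs hC hb hR fun t i => ?_
  split_ifs
  · exact abs_esymmCoef_le _ _
  · exact abs_brunCoef_le _ _

theorem brun_hooley (hs : Pairwise (Function.onFun Disjoint s)) (hk : ∀ l, Even (k l))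
    (hN : 0 ≤ N) (hC : 0 ≤ C) (hb0 : ∀ m p, 0 ≤ b m p) (hb1 : ∀ m p, b m p ≤ 1)
    (hρ0 : ∀ l, ∀ p ∈ s l, 0 ≤ ρ p) (hρ1 : ∀ l, ∀ p ∈ s l, ρ p ≤ 1)
    (hb : ∀ S ⊆ univ.biUnion s, |∑ m ∈ A, ∏ p ∈ S, b m p - N * ∏ p ∈ S, ρ p| ≤ C ^ #S)
    (hR : ∏ l, weightedSum (truncCoef (k l + 1)) (s l) (fun _ => C) ≤ R) {θ : ι → ℝ}
    (hθ0 : ∀ l, 0 ≤ θ l)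
    (hθ : ∀ l, weightedSum (esymmCoef (k l + 1)) (s l) ρ ≤ θ l * ∏ p ∈ s l, (1 - ρ p)) :
    |∑ m ∈ A, ∏ l, ∏ p ∈ s l, (1 - b m p) - N * ∏ l, ∏ p ∈ s l, (1 - ρ p)| ≤
      (Fintype.card ι + 1) * R +
        N * ((∏ l, ∏ p ∈ s l, (1 - ρ p)) * ((∑ l, θ l) * Real.exp (∑ l, θ l))) := by
  classical
  set P : (α → ℝ) → ℝ := fun x => ∏ l, ∏ p ∈ s l, (1 - x p)
  have hE : N * hooleyError k s ρ ≤ N * (P ρ * ((∑ l, θ l) * Real.exp (∑ l, θ l))) :=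
    mul_le_mul_of_nonneg_left (hooleyError_le hk hρ0 hρ1 hθ0 hθ) hN
  have hUρ : N * P ρ ≤ N * hooleyUpper k s ρ :=
    mul_le_mul_of_nonneg_left (prod_prod_one_sub_le_hooleyUpper hk hρ0 hρ1) hN
  have hUEρ : N * (hooleyUpper k s ρ - P ρ) ≤ N * hooleyError k s ρ :=
    mul_le_mul_of_nonneg_left (hooleyUpper_sub_le_hooleyError hk hρ0 hρ1) hN
  have hU : ∑ m ∈ A, P (b m) ≤ ∑ m ∈ A, hooleyUpper k s (b m) := sum_le_sum fun m _ =>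
    prod_prod_one_sub_le_hooleyUpper hk (fun _ p _ => hb0 m p) fun _ p _ => hb1 m p
  have hUE : ∑ m ∈ A, (hooleyUpper k s (b m) - P (b m)) ≤ ∑ m ∈ A, hooleyError k s (b m) :=
    sum_le_sum fun m _ =>
      hooleyUpper_sub_le_hooleyError hk (fun _ p _ => hb0 m p) fun _ p _ => hb1 m p
  rw [sum_sub_distrib] at hUE
  obtain ⟨hUlow, hUup⟩ := abs_le.mp (abs_sum_hooleyUpper_sub_le hs hC hb hR)
  obtain ⟨-, hEup⟩ := abs_le.mp (abs_sum_hooleyError_sub_le hs hC hb hR)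
  have hcardR : 0 ≤ Fintype.card ι * R :=
    (abs_nonneg _).trans (abs_sum_hooleyError_sub_le hs hC hb hR)
  rw [abs_le]
  constructor <;> linarith

end Remainder

end BrunHooley

section ResidueClasses

/-- The indicator function of `m` lying modulo `p` in the set `Ω p` of sieved residue classes. -/
def hit (Ω : ∀ p : ℕ, Finset (ZMod p)) (m p : ℕ) : ℝ := if (m : ZMod p) ∈ Ω p then 1 else 0

theorem hit_nonneg (Ω : ∀ p : ℕ, Finset (ZMod p)) (m p : ℕ) : 0 ≤ hit Ω m p := by
  unfold hit; split_ifs <;> norm_num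

theorem hit_le_one (Ω : ∀ p : ℕ, Finset (ZMod p)) (m p : ℕ) : hit Ω m p ≤ 1 := by
  unfold hit; split_ifs <;> norm_num

theorem abs_sum_cast_eq_sub_le (X : ℕ) {d : ℕ} (hd : 0 < d) (c : ZMod d) :
    |∑ m ∈ range X, (if (m : ZMod d) = c then (1 : ℝ) else 0) - X / d| ≤ 1 := by
  have : NeZero d := ⟨hd.ne'⟩
  have hcount : ∑ m ∈ range X, (if (m : ZMod d) = c then (1 : ℝ) else 0) =
      ⌈((X : ℝ) - c.val) / d⌉ := by
    have hceil := Nat.count_modEq_card_eq_ceil (b := X) hd c.val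
    rw [Nat.mod_eq_of_lt c.val_lt] at hceil
    have hmod (m : ℕ) : (m : ZMod d) = c ↔ m ≡ c.val [MOD d] := by
      rw [← ZMod.natCast_eq_natCast_iff, ZMod.natCast_zmod_val]
    simp only [hmod]
    rw [sum_boole, ← Nat.count_eq_card_filter_range, ← Int.cast_natCast, hceil]
    exact congrArg _ (by rw [← Rat.ceil_cast (α := ℝ)]; push_cast; rfl)
  have hd' : (0 : ℝ) < d := by exact_mod_cast hd
  have hc0 : 0 ≤ (c.val : ℝ) / d := by positivity
  have hc1 : (c.val : ℝ) / d ≤ 1 := (div_le_one hd').mpr (by exact_mod_cast c.val_lt.le)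
  have hlow := Int.le_ceil (((X : ℝ) - c.val) / d)
  have hup := Int.ceil_lt_add_one (((X : ℝ) - c.val) / d)
  rw [sub_div] at hlow hup
  rw [hcount, sub_div, abs_le]
  constructor <;> linarith

theorem ite_cast_eq_mul_hit (Ω : ∀ p : ℕ, Finset (ZMod p)) {d q : ℕ} (hdq : d.Coprime q)
    (c : ZMod d) (m : ℕ) : (if (m : ZMod d) = c then (1 : ℝ) else 0) * hit Ω m q =
      ∑ r ∈ Ω q, if (m : ZMod (d * q)) = (ZMod.chineseRemainder hdq).symm (c, r) then 1 else 0 := by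
  have hcrt (r : ZMod q) : (m : ZMod (d * q)) = (ZMod.chineseRemainder hdq).symm (c, r) ↔
      (m : ZMod d) = c ∧ (m : ZMod q) = r := by
    rw [RingEquiv.eq_symm_apply, map_natCast, Prod.ext_iff]
    rfl
  by_cases hc : (m : ZMod d) = c <;> simp [hcrt, hc, hit]

theorem abs_sum_ite_mul_prod_hit_sub_le (Ω : ∀ p : ℕ, Finset (ZMod p)) (X : ℕ) {S : Finset ℕ}
    (hS0 : ∀ p ∈ S, 0 < p) (hS : (S : Set ℕ).Pairwise Nat.Coprime) {d : ℕ} (hd : 0 < d)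
    (hdS : ∀ p ∈ S, d.Coprime p) (c : ZMod d) :
    |∑ m ∈ range X, (if (m : ZMod d) = c then (1 : ℝ) else 0) * ∏ p ∈ S, hit Ω m p -
        X / d * ∏ p ∈ S, (#(Ω p) / p : ℝ)| ≤ ∏ p ∈ S, (#(Ω p) : ℝ) := by
  induction S using Finset.induction_on generalizing d with
  | empty => simpa using abs_sum_cast_eq_sub_le X hd c
  | insert q S hq ih =>
    obtain ⟨hq0, hS0⟩ := forall_mem_insert .. |>.mp hS0
    obtain ⟨hdq, hdS⟩ := forall_mem_insert .. |>.mp hdS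
    rw [coe_insert, Set.pairwise_insert_of_symm] at hS
    have hdqS : ∀ p ∈ S, (d * q).Coprime p := fun p hp =>
      (hdS p hp).mul_left (hS.2 p hp (ne_of_mem_of_not_mem hp hq).symm)
    have hsum : ∑ m ∈ range X, (if (m : ZMod d) = c then (1 : ℝ) else 0) *
        ∏ p ∈ insert q S, hit Ω m p = ∑ r ∈ Ω q, ∑ m ∈ range X,
          (if (m : ZMod (d * q)) = (ZMod.chineseRemainder hdq).symm (c, r) then (1 : ℝ) else 0) *
            ∏ p ∈ S, hit Ω m p := by
      rw [sum_comm]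
      refine sum_congr rfl fun m _ => ?_
      rw [prod_insert hq, ← mul_assoc, ite_cast_eq_mul_hit Ω hdq, sum_mul]
    have hmain : (X : ℝ) / d * ∏ p ∈ insert q S, (#(Ω p) / p : ℝ) =
        ∑ _r ∈ Ω q, (X : ℝ) / (d * q : ℕ) * ∏ p ∈ S, (#(Ω p) / p : ℝ) := by
      rw [sum_const, prod_insert hq, nsmul_eq_mul, Nat.cast_mul, ← div_div]
      ring
    rw [hsum, hmain, ← sum_sub_distrib, prod_insert hq, ← nsmul_eq_mul]
    exact (abs_sum_le_sum_abs _ _).trans (sum_le_card_nsmul _ _ _ fun r _ =>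
      ih hS0 hS.1 (Nat.mul_pos hd hq0) hdqS _)

theorem abs_sum_prod_hit_sub_le (Ω : ∀ p : ℕ, Finset (ZMod p)) (X : ℕ) {S : Finset ℕ}
    (hS0 : ∀ p ∈ S, 0 < p) (hS : (S : Set ℕ).Pairwise Nat.Coprime) :
    |∑ m ∈ range X, ∏ p ∈ S, hit Ω m p - X * ∏ p ∈ S, (#(Ω p) / p : ℝ)| ≤
      ∏ p ∈ S, (#(Ω p) : ℝ) := by
  simpa [Subsingleton.elim _ (0 : ZMod 1)] using
    abs_sum_ite_mul_prod_hit_sub_le Ω X hS0 hS one_pos (fun p _ => Nat.coprime_one_left p) 0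

end ResidueClasses

section PrimeReciprocals

theorem sum_Icc_inv_le {r n : ℕ} (hr : 0 < r) (hrn : r ≤ n) :
    ∑ i ∈ Icc r n, (1 / i : ℝ) ≤ 1 + Real.log (n / r) := by
  have hr' : (1 : ℝ) ≤ r := by exact_mod_cast hr
  induction n, hrn using Nat.le_induction with
  | base => simpa using inv_le_one_of_one_le₀ hr'
  | succ n hn ih =>
    have hn' : (1 : ℝ) ≤ n := by exact_mod_cast hr.trans_le hn
    have hstep : 1 / (n + 1 : ℝ) ≤ Real.log ((n + 1) / n) :=
      calc 1 / (n + 1 : ℝ) = 1 - ((n + 1 : ℝ) / n)⁻¹ := by field_simp; ring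
        _ ≤ Real.log ((n + 1) / n) := Real.one_sub_inv_le_log_of_pos (by positivity)
    have hlog : Real.log ((n + 1 : ℝ) / r) = Real.log (n / r) + Real.log ((n + 1) / n) := by
      rw [← Real.log_mul (by positivity) (by positivity)]
      congr 1; field_simp
    rw [sum_Icc_succ_top (by lia)]
    push_cast
    linarith

theorem mul_card_primes_dyadic_le {i : ℕ} {s : Finset ℕ}
    (hs : ∀ p ∈ s, p.Prime ∧ 2 ^ i ≤ p ∧ p < 2 ^ (i + 1)) : i * #s ≤ 4 * 2 ^ i := by
  have hprod : (2 ^ i) ^ #s ≤ primorial (2 ^ (i + 1)) :=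
    calc (2 ^ i) ^ #s ≤ ∏ p ∈ s, p := pow_card_le_prod s _ _ fun p hp => (hs p hp).2.1
      _ ≤ primorial (2 ^ (i + 1)) := by
        refine prod_le_prod_of_subset_of_one_le' (fun p hp => ?_) fun p hp _ =>
          (mem_filter.mp hp).2.one_le
        exact mem_filter.mpr ⟨mem_range_succ_iff.mpr (hs p hp).2.2.le, (hs p hp).1⟩
  have hexp : i * #s ≤ 2 * 2 ^ (i + 1) := by
    rw [← Nat.pow_le_pow_iff_right one_lt_two, pow_mul, pow_mul]
    exact hprod.trans (primorial_le_four_pow _)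
  rwa [pow_succ', ← mul_assoc] at hexp

theorem sum_inv_primes_dyadic_le {i : ℕ} (hi : 0 < i) {s : Finset ℕ}
    (hs : ∀ p ∈ s, p.Prime ∧ 2 ^ i ≤ p ∧ p < 2 ^ (i + 1)) :
    ∑ p ∈ s, (1 / p : ℝ) ≤ 4 * (1 / i) := by
  have hcard : (i : ℝ) * #s ≤ 4 * 2 ^ i := by exact_mod_cast mul_card_primes_dyadic_le hs
  have hi' : (0 : ℝ) < i := by exact_mod_cast hi
  calc ∑ p ∈ s, (1 / p : ℝ) ≤ #s • (1 / 2 ^ i : ℝ) := by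
        refine sum_le_card_nsmul _ _ _ fun p hp => ?_
        have : (2 ^ i : ℝ) ≤ p := by exact_mod_cast (hs p hp).2.1
        gcongr
    _ ≤ 4 * (1 / i) := by
        rw [nsmul_eq_mul, mul_one_div, mul_one_div, div_le_div_iff₀ (by positivity) hi']
        linarith

theorem sum_Icc_inv_mul_le {r T : ℕ} (hr : 0 < r) (hT : 0 < T) :
    ∑ i ∈ Icc r ((r + 1) * T), (1 / i : ℝ) ≤ 2 * (1 + Real.log T) := by
  have hr' : (1 : ℝ) ≤ r := by exact_mod_cast hr
  have hT' : (1 : ℝ) ≤ T := by exact_mod_cast hT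
  have hratio : ((r + 1) * T : ℝ) / r ≤ 2 * T := by
    rw [div_le_iff₀ (by positivity)]; nlinarith
  calc ∑ i ∈ Icc r ((r + 1) * T), (1 / i : ℝ) ≤ 1 + Real.log (((r + 1) * T : ℕ) / r) :=
        sum_Icc_inv_le hr (by nlinarith)
    _ ≤ 1 + Real.log (2 * T) := by push_cast; gcongr
    _ = 1 + (Real.log 2 + Real.log T) := by rw [Real.log_mul two_ne_zero (by positivity)]
    _ ≤ 2 * (1 + Real.log T) := by linarith [Real.log_two_lt_d9, Real.log_nonneg hT']

theorem sum_inv_primes_le {T : ℕ} (hT : 0 < T) {s : Finset ℕ} (hs : ∀ p ∈ s, p.Prime)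
    (hsT : ∀ p ∈ s, ∀ q ∈ s, q < p ^ T) : ∑ p ∈ s, (1 / p : ℝ) ≤ 8 * (1 + Real.log T) := by
  rcases s.eq_empty_or_nonempty with rfl | hne
  · have := Real.log_natCast_nonneg T
    rw [sum_empty]; positivity
  set q := s.min' hne
  have hq : q ∈ s := s.min'_mem hne
  set r := Nat.log 2 q
  have hr : 0 < r := Nat.log_pos one_lt_two (hs q hq).two_le
  have hqr : q < 2 ^ (r + 1) := Nat.lt_pow_succ_log_self one_lt_two _
  have hlog : ∀ p ∈ s, Nat.log 2 p ∈ Icc r ((r + 1) * T) := fun p hp => by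
    refine mem_Icc.mpr ⟨Nat.log_mono_right (s.min'_le p hp), ?_⟩
    refine (Nat.log_lt_of_lt_pow (hs p hp).ne_zero ?_).le
    calc p < q ^ T := hsT q hq p hp
      _ ≤ (2 ^ (r + 1)) ^ T := Nat.pow_le_pow_left hqr.le T
      _ = 2 ^ ((r + 1) * T) := (pow_mul _ _ _).symm
  have hdyadic : ∀ i ∈ Icc r ((r + 1) * T),
      ∑ p ∈ s with Nat.log 2 p = i, (1 / p : ℝ) ≤ 4 * (1 / i) := fun i hi => by
    refine sum_inv_primes_dyadic_le (hr.trans_le (mem_Icc.mp hi).1) fun p hp => ?_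
    obtain ⟨hps, rfl⟩ := mem_filter.mp hp
    exact ⟨hs p hps, Nat.pow_log_le_self 2 (hs p hps).ne_zero,
      Nat.lt_pow_succ_log_self one_lt_two p⟩
  calc ∑ p ∈ s, (1 / p : ℝ)
      = ∑ i ∈ Icc r ((r + 1) * T), ∑ p ∈ s with Nat.log 2 p = i, (1 / p : ℝ) :=
        (sum_fiberwise_of_maps_to hlog _).symm
    _ ≤ ∑ i ∈ Icc r ((r + 1) * T), 4 * (1 / i : ℝ) := sum_le_sum hdyadic
    _ ≤ 4 * (2 * (1 + Real.log T)) := by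
        rw [← mul_sum]; exact mul_le_mul_of_nonneg_left (sum_Icc_inv_mul_le hr hT) zero_le_four
    _ = 8 * (1 + Real.log T) := by ring

theorem exp_neg_le_one_sub_div {c p : ℕ} (hc : c ≤ 2) (hcp : c < p) :
    Real.exp (-(6 * (1 / p))) ≤ 1 - c / p := by
  have hc' : (c : ℝ) ≤ 2 := by exact_mod_cast hc
  have hcp' : (c : ℝ) + 1 ≤ p := by exact_mod_cast hcp
  have hp : (0 : ℝ) < p := by exact_mod_cast c.zero_le.trans_lt hcp
  have hpos : (0 : ℝ) < 1 - c / p := by rw [sub_pos, div_lt_one hp]; linarith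
  rw [← Real.le_log_iff_exp_le hpos]
  calc -(6 * (1 / p) : ℝ) ≤ -(c / (p - c)) := by
        rw [neg_le_neg_iff, mul_one_div, div_le_div_iff₀ (by linarith) hp]
        nlinarith [(c.cast_nonneg : (0 : ℝ) ≤ c)]
    _ = 1 - (1 - c / p : ℝ)⁻¹ := by
        have : (p : ℝ) - c ≠ 0 := by linarith
        rw [one_sub_div hp.ne', inv_div]; field_simp; ring
    _ ≤ Real.log (1 - c / p) := Real.one_sub_inv_le_log_of_pos hpos

theorem exp_neg_sum_le_prod_one_sub {s : Finset ℕ} {c : ℕ → ℕ} (hc : ∀ p ∈ s, c p ≤ 2)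
    (hcp : ∀ p ∈ s, c p < p) :
    Real.exp (-(6 * ∑ p ∈ s, (1 / p : ℝ))) ≤ ∏ p ∈ s, (1 - c p / p : ℝ) := by
  rw [mul_sum, ← sum_neg_distrib, Real.exp_sum]
  exact prod_le_prod (fun p _ => (Real.exp_pos _).le)
    fun p hp => exp_neg_le_one_sub_div (hc p hp) (hcp p hp)

end PrimeReciprocals

section PrimeBlocks

/-- The primes `p ≤ y` with `T ^ l ≤ log y / log p < T ^ (l + 1)`. -/
def primeBlock (T y l : ℕ) : Finset ℕ := {p ∈ y.primesLE | Nat.log T (Nat.log p y) = l}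

variable {T k y l : ℕ}

theorem primeBlock_subset : primeBlock T y l ⊆ y.primesLE := filter_subset _ _

theorem prime_of_mem_primeBlock {p : ℕ} (hp : p ∈ primeBlock T y l) : p.Prime :=
  (Nat.mem_primesLE.mp (primeBlock_subset hp)).2

theorem le_of_mem_primeBlock {p : ℕ} (hp : p ∈ primeBlock T y l) : p ≤ y :=
  (Nat.mem_primesLE.mp (primeBlock_subset hp)).1

theorem pow_le_of_mem_primeBlock {p : ℕ} (hp : p ∈ primeBlock T y l) : p ^ T ^ l ≤ y := by
  have hlog : 0 < Nat.log p y :=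
    Nat.log_pos (prime_of_mem_primeBlock hp).one_lt (le_of_mem_primeBlock hp)
  refine Nat.pow_le_of_le_log ?_ ?_
  · exact ((prime_of_mem_primeBlock hp).pos.trans_le (le_of_mem_primeBlock hp)).ne'
  · exact (mem_filter.mp hp).2 ▸ Nat.pow_log_le_self T hlog.ne'

theorem lt_pow_of_mem_primeBlock (hT : 1 < T) {p : ℕ} (hp : p ∈ primeBlock T y l) :
    y < p ^ T ^ (l + 1) :=
  Nat.lt_pow_of_log_lt (prime_of_mem_primeBlock hp).one_lt
    ((mem_filter.mp hp).2 ▸ Nat.lt_pow_succ_log_self hT _)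

theorem pairwise_disjoint_primeBlock (T y : ℕ) :
    Pairwise (Function.onFun Disjoint (primeBlock T y)) := fun _ _ hab =>
  disjoint_left.mpr fun _ ha hb => hab ((mem_filter.mp ha).2.symm.trans (mem_filter.mp hb).2)

theorem prod_primeBlock (T y : ℕ) (f : ℕ → ℝ) :
    ∏ l : Fin y, ∏ p ∈ primeBlock T y l, f p = ∏ p ∈ y.primesLE, f p := by
  rw [← prod_range fun l => ∏ p ∈ primeBlock T y l, f p]
  refine prod_fiberwise_of_maps_to (fun p hp => mem_range.mpr ?_) f
  obtain ⟨hpy, hp⟩ := Nat.mem_primesLE.mp hp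
  exact (Nat.log_le_self _ _).trans_lt (Nat.log_lt_self _ (hp.pos.trans_le hpy).ne')

theorem sum_inv_primeBlock_le (hT : 1 < T) (y l : ℕ) :
    ∑ p ∈ primeBlock T y l, (1 / p : ℝ) ≤ 8 * (1 + Real.log T) := by
  refine sum_inv_primes_le (by lia) (fun p => prime_of_mem_primeBlock) fun p hp q hq => ?_
  refine lt_of_pow_lt_pow_left₀ (T ^ l) (Nat.zero_le _) ?_
  calc q ^ T ^ l ≤ y := pow_le_of_mem_primeBlock hq
    _ < p ^ T ^ (l + 1) := lt_pow_of_mem_primeBlock hT hp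
    _ = (p ^ T) ^ T ^ l := by rw [← pow_mul, ← pow_succ']

theorem one_add_two_mul_card_le_sq {s : Finset ℕ} {q : ℕ} (hq : 2 ≤ q)
    (hs : ∀ p ∈ s, 2 ≤ p ∧ p ≤ q) : 1 + 2 * #s ≤ q ^ 2 := by
  have hcard : #s ≤ q - 1 := by
    simpa using card_le_card fun p hp => mem_Icc.mpr (hs p hp)
  nlinarith [Nat.sub_add_cancel (by lia : 1 ≤ q)]

theorem mul_two_pow_add_one_mul_two_pow_le (k : ℕ) (hl : l ≠ 0) :
    (k * 2 ^ l + 1) * 2 ^ l ≤ 4 * (k + 4) ^ l := by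
  obtain ⟨t, rfl⟩ := Nat.exists_eq_succ_of_ne_zero hl
  calc (k * 2 ^ (t + 1) + 1) * 2 ^ (t + 1)
      ≤ (k * 2 ^ (t + 1) + 2 ^ (t + 1)) * 2 ^ (t + 1) := by gcongr; exact Nat.one_le_two_pow
    _ = 4 * ((k + 1) * 4 ^ t) := by rw [(by norm_num : 4 = 2 * 2), mul_pow]; ring
    _ ≤ 4 * ((k + 4) * (k + 4) ^ t) := by gcongr <;> lia
    _ = 4 * (k + 4) ^ (t + 1) := by rw [pow_succ']

theorem weightedSum_truncCoef_primeBlock_le (k : ℕ) (hy : 1 ≤ y) (hl : l ≠ 0) :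
    weightedSum (truncCoef (k * 2 ^ l + 1)) (primeBlock (k + 4) y l) (fun _ => 2) ≤
      (y : ℝ) ^ (8 * (1 / 2 : ℝ) ^ l) := by
  have hy1 : (1 : ℝ) ≤ y := by exact_mod_cast hy
  set s := primeBlock (k + 4) y l
  rcases s.eq_empty_or_nonempty with he | hne
  · rw [he, weightedSum_empty]
    simpa [truncCoef] using Real.one_le_rpow hy1 (by positivity)
  set q := s.max' hne
  have hq : q ∈ s := s.max'_mem hne
  have hcard : (1 + 2 * #s : ℝ) ≤ q ^ 2 := by
    exact_mod_cast one_add_two_mul_card_le_sq (prime_of_mem_primeBlock hq).two_le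
      fun p hp => ⟨(prime_of_mem_primeBlock hp).two_le, s.le_max' p hp⟩
  have hqy : (q : ℝ) ≤ (y : ℝ) ^ ((k + 4 : ℝ) ^ l)⁻¹ := by
    rw [Real.le_rpow_inv_iff_of_pos (by positivity) (by positivity) (by positivity)]
    exact_mod_cast pow_le_of_mem_primeBlock hq
  have hexp : ((k + 4 : ℝ) ^ l)⁻¹ * (2 * (k * 2 ^ l + 1) : ℕ) ≤ 8 * (1 / 2) ^ l := by
    have := (Nat.cast_le (α := ℝ)).mpr (mul_two_pow_add_one_mul_two_pow_le k hl)
    push_cast at this ⊢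
    rw [one_div, inv_pow, inv_mul_eq_div, ← div_eq_mul_inv, div_le_div_iff₀ (by positivity)
      (by positivity)]
    linarith
  calc weightedSum (truncCoef (k * 2 ^ l + 1)) s (fun _ => 2)
      ≤ (1 + 2 * #s) ^ (k * 2 ^ l + 1) := by
        simpa [mul_comm] using
          weightedSum_truncCoef_le_pow (k * 2 ^ l + 1) (s := s) (x := fun _ => 2) (by simp)
    _ ≤ ((q : ℝ) ^ 2) ^ (k * 2 ^ l + 1) := by gcongr
    _ = (q : ℝ) ^ (2 * (k * 2 ^ l + 1)) := (pow_mul _ _ _).symm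
    _ ≤ ((y : ℝ) ^ ((k + 4 : ℝ) ^ l)⁻¹) ^ (2 * (k * 2 ^ l + 1)) := by gcongr
    _ = (y : ℝ) ^ (((k + 4 : ℝ) ^ l)⁻¹ * (2 * (k * 2 ^ l + 1) : ℕ)) :=
        (Real.rpow_mul_natCast (by positivity) _ _).symm
    _ ≤ (y : ℝ) ^ (8 * (1 / 2 : ℝ) ^ l) := Real.rpow_le_rpow_of_exponent_le hy1 hexp

theorem prod_weightedSum_truncCoef_primeBlock_le (hy : 1 ≤ y) (hky : k + 1 ≤ 2 * y) :
    ∏ l : Fin y, weightedSum (truncCoef (k * 2 ^ (l : ℕ) + 1)) (primeBlock (k + 4) y l)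
        (fun _ => 2) ≤ (k + 2) * ((2 * y : ℝ) ^ (k + 1) / (k + 1)!) * y ^ 16 := by
  set R : ℝ := (k + 2) * ((2 * y : ℝ) ^ (k + 1) / (k + 1)!)
  have hy1 : (1 : ℝ) ≤ y := by exact_mod_cast hy
  have hfirst : weightedSum (truncCoef (k + 1)) (primeBlock (k + 4) y 0) (fun _ => 2) ≤ R := by
    have hcard : #(primeBlock (k + 4) y 0) ≤ y := by
      simpa using card_le_card fun p hp => mem_Icc.mpr
        ⟨(prime_of_mem_primeBlock hp).one_le, le_of_mem_primeBlock hp⟩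
    have := weightedSum_truncCoef_le (k := k + 1) (s := primeBlock (k + 4) y 0) (x := fun _ => 2)
      (A := 2 * y) (by simp)
      (by rw [sum_const, nsmul_eq_mul, mul_comm]; gcongr) (by exact_mod_cast hky)
    push_cast at this
    rwa [add_assoc, one_add_one_eq_two] at this
  have hblock (l : Fin y) :
      weightedSum (truncCoef (k * 2 ^ (l : ℕ) + 1)) (primeBlock (k + 4) y l) (fun _ => 2) ≤
        (if l = ⟨0, hy⟩ then R else 1) * (y : ℝ) ^ (8 * (1 / 2 : ℝ) ^ (l : ℕ)) := by
    split_ifs with h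
    · subst h
      rw [pow_zero, mul_one]
      exact hfirst.trans (le_mul_of_one_le_right (by positivity)
        (Real.one_le_rpow hy1 (by positivity)))
    · rw [one_mul]
      exact weightedSum_truncCoef_primeBlock_le k hy fun h0 => h (Fin.ext h0)
  have hexp : ∑ l : Fin y, 8 * (1 / 2 : ℝ) ^ (l : ℕ) ≤ 16 := by
    rw [← mul_sum, ← sum_range fun l => (1 / 2 : ℝ) ^ l]
    linarith [sum_geometric_two_le y]
  calc _ ≤ ∏ l : Fin y, (if l = ⟨0, hy⟩ then R else 1) * (y : ℝ) ^ (8 * (1 / 2 : ℝ) ^ (l : ℕ)) :=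
        prod_le_prod (fun l _ => weightedSum_nonneg
          (fun i => (abs_nonneg _).trans (abs_esymmCoef_le _ i)) fun _ _ => zero_le_two)
          fun l _ => hblock l
    _ = R * (y : ℝ) ^ ∑ l : Fin y, 8 * (1 / 2 : ℝ) ^ (l : ℕ) := by
        rw [prod_mul_distrib, prod_ite_eq' univ _ fun _ => R, if_pos (mem_univ _),
          Real.rpow_sum_of_pos (by positivity)]
    _ ≤ R * (y : ℝ) ^ (16 : ℝ) := by gcongr
    _ = R * (y : ℝ) ^ 16 := by norm_cast

end PrimeBlocks

section FundamentalLemma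

theorem pow_add_div_factorial_le {Λ : ℝ} (hΛ : 0 ≤ Λ) (a b : ℕ) :
    Λ ^ (a + b) / (a + b)! ≤ Λ ^ a / a ! * (Λ ^ b / b !) := by
  have : (a ! * b ! : ℝ) ≤ (a + b)! := by
    exact_mod_cast Nat.le_of_dvd (Nat.factorial_pos _)
      (Nat.factorial_mul_factorial_dvd_factorial_add a b)
  rw [pow_add, div_mul_div_comm]
  gcongr

theorem sum_pow_div_factorial_le_exp {Λ : ℝ} (hΛ : 0 ≤ Λ) (s : Finset ℕ) :
    ∑ d ∈ s, Λ ^ d / d ! ≤ Real.exp Λ := by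
  obtain ⟨n, hn⟩ := s.exists_nat_subset_range
  exact (sum_le_sum_of_subset_of_nonneg hn fun _ _ _ => by positivity).trans
    (Real.sum_le_exp_of_nonneg hΛ n)

theorem sum_pow_mul_two_pow_div_factorial_le {Λ : ℝ} (hΛ : 0 ≤ Λ) {k : ℕ} (hk : 0 < k) (J : ℕ) :
    ∑ l ∈ range J, Λ ^ (k * 2 ^ l + 1) / (k * 2 ^ l + 1)! ≤
      Λ ^ (k + 1) / (k + 1)! * Real.exp Λ := by
  have hinj : Function.Injective fun l => k * (2 ^ l - 1) := fun a b hab => by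
    have hsub : 2 ^ a - 1 = 2 ^ b - 1 := Nat.eq_of_mul_eq_mul_left hk hab
    have ha := Nat.one_le_two_pow (n := a)
    have hb := Nat.one_le_two_pow (n := b)
    exact Nat.pow_right_injective le_rfl (by dsimp only; lia)
  have hsplit (l : ℕ) : k * 2 ^ l + 1 = k + 1 + k * (2 ^ l - 1) := by
    obtain ⟨t, ht⟩ := Nat.exists_eq_add_of_le (Nat.one_le_two_pow (n := l))
    rw [ht, Nat.add_sub_cancel_left]; ring
  calc ∑ l ∈ range J, Λ ^ (k * 2 ^ l + 1) / (k * 2 ^ l + 1)!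
      ≤ ∑ l ∈ range J, Λ ^ (k + 1) / (k + 1)! * (Λ ^ (k * (2 ^ l - 1)) / (k * (2 ^ l - 1))!) :=
        sum_le_sum fun l _ => by rw [hsplit l]; exact pow_add_div_factorial_le hΛ _ _
    _ = Λ ^ (k + 1) / (k + 1)! * ∑ d ∈ (range J).image fun l => k * (2 ^ l - 1), Λ ^ d / d ! := by
        rw [← mul_sum, sum_image hinj.injOn]
    _ ≤ Λ ^ (k + 1) / (k + 1)! * Real.exp Λ := by
        gcongr; exact sum_pow_div_factorial_le_exp hΛ _

/-- A bound for the sum of `2 / p` over any of the blocks `primeBlock (k + 4) y l`. -/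
def blockBound (k : ℕ) : ℝ := 16 * (1 + Real.log (k + 4))

/-- A bound for the relative error of the Brun-Hooley sieve of dimension two which is truncated
after `k * 2 ^ l` primes in the block `primeBlock (k + 4) y l`. -/
def sieveSaving (k : ℕ) : ℝ :=
  Real.exp (4 * blockBound k) * (blockBound k ^ (k + 1) / (k + 1)!)

theorem blockBound_pos (k : ℕ) : 0 < blockBound k := by
  have : 0 ≤ Real.log (k + 4) := Real.log_nonneg (by linarith [(k.cast_nonneg : (0 : ℝ) ≤ k)])
  unfold blockBound; positivity

theorem sieveSaving_nonneg (k : ℕ) : 0 ≤ sieveSaving k := by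
  have := blockBound_pos k
  unfold sieveSaving; positivity

theorem two_mul_sum_inv_primeBlock_le (k y l : ℕ) :
    2 * ∑ p ∈ primeBlock (k + 4) y l, (1 / p : ℝ) ≤ blockBound k := by
  have := sum_inv_primeBlock_le (T := k + 4) (by lia) y l
  push_cast at this
  unfold blockBound
  linarith

variable {Ω : ∀ p : ℕ, Finset (ZMod p)}

theorem sum_card_div_primeBlock_le (hΩ : ∀ p : ℕ, p.Prime → #(Ω p) ≤ 2) (k y l : ℕ) :
    ∑ p ∈ primeBlock (k + 4) y l, (#(Ω p) / p : ℝ) ≤ blockBound k := by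
  refine le_trans ?_ (two_mul_sum_inv_primeBlock_le k y l)
  rw [mul_sum]
  refine sum_le_sum fun p hp => ?_
  have : (#(Ω p) : ℝ) ≤ 2 := by exact_mod_cast hΩ p (prime_of_mem_primeBlock hp)
  rw [mul_one_div]
  gcongr

theorem exp_neg_blockBound_le_prod (hΩ : ∀ p : ℕ, p.Prime → #(Ω p) ≤ 2)
    (hΩp : ∀ p : ℕ, p.Prime → #(Ω p) < p) (k y l : ℕ) :
    Real.exp (-(3 * blockBound k)) ≤ ∏ p ∈ primeBlock (k + 4) y l, (1 - #(Ω p) / p : ℝ) := by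
  refine le_trans (Real.exp_le_exp.mpr ?_) (exp_neg_sum_le_prod_one_sub
    (fun p hp => hΩ p (prime_of_mem_primeBlock hp)) fun p hp => hΩp p (prime_of_mem_primeBlock hp))
  linarith [two_mul_sum_inv_primeBlock_le k y l]

/-- A bound for the relative truncation error of inclusion-exclusion on the block
`primeBlock (k + 4) y l` after `k * 2 ^ l` primes. -/
def blockError (k l : ℕ) : ℝ :=
  Real.exp (3 * blockBound k) * (blockBound k ^ (k * 2 ^ l + 1) / (k * 2 ^ l + 1)!)

theorem sum_blockError_le {k : ℕ} (hk : 0 < k) (J : ℕ) :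
    ∑ l ∈ range J, blockError k l ≤ sieveSaving k :=
  calc ∑ l ∈ range J, blockError k l
      = Real.exp (3 * blockBound k) *
          ∑ l ∈ range J, blockBound k ^ (k * 2 ^ l + 1) / (k * 2 ^ l + 1)! := (mul_sum ..).symm
    _ ≤ Real.exp (3 * blockBound k) *
          (blockBound k ^ (k + 1) / (k + 1)! * Real.exp (blockBound k)) := by
        gcongr; exact sum_pow_mul_two_pow_div_factorial_le (blockBound_pos k).le hk J
    _ = sieveSaving k := by
        rw [sieveSaving, (by ring : 4 * blockBound k = 3 * blockBound k + blockBound k),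
          Real.exp_add]
        ring

theorem weightedSum_esymmCoef_primeBlock_le (hΩ : ∀ p : ℕ, p.Prime → #(Ω p) ≤ 2)
    (hΩp : ∀ p : ℕ, p.Prime → #(Ω p) < p) (k y l d : ℕ) :
    weightedSum (esymmCoef d) (primeBlock (k + 4) y l) (fun p => (#(Ω p) / p : ℝ)) ≤
      Real.exp (3 * blockBound k) * (blockBound k ^ d / d !) *
        ∏ p ∈ primeBlock (k + 4) y l, (1 - #(Ω p) / p : ℝ) := by
  have hΛ := blockBound_pos k
  have hρ : ∀ p ∈ primeBlock (k + 4) y l, (0 : ℝ) ≤ #(Ω p) / p := fun p _ => by positivity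
  have hprod : 1 ≤ Real.exp (3 * blockBound k) *
      ∏ p ∈ primeBlock (k + 4) y l, (1 - #(Ω p) / p : ℝ) := by
    rw [← neg_neg (3 * blockBound k), Real.exp_neg, ← div_eq_inv_mul, one_le_div (Real.exp_pos _)]
    exact exp_neg_blockBound_le_prod hΩ hΩp k y l
  calc _ ≤ (∑ p ∈ primeBlock (k + 4) y l, (#(Ω p) / p : ℝ)) ^ d / d ! :=
        weightedSum_esymmCoef_le d hρ
    _ ≤ blockBound k ^ d / d ! := by
        have := sum_nonneg hρ
        gcongr
        exact sum_card_div_primeBlock_le hΩ k y l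
    _ ≤ blockBound k ^ d / d ! * (Real.exp (3 * blockBound k) *
          ∏ p ∈ primeBlock (k + 4) y l, (1 - #(Ω p) / p : ℝ)) :=
        le_mul_of_one_le_right (by positivity) hprod
    _ = _ := by ring

theorem card_div_le_one (hΩp : ∀ p : ℕ, p.Prime → #(Ω p) < p) {p : ℕ} (hp : p.Prime) :
    (#(Ω p) / p : ℝ) ≤ 1 :=
  div_le_one_of_le₀ (by exact_mod_cast (hΩp p hp).le) p.cast_nonneg

theorem prod_one_sub_card_div_nonneg (hΩp : ∀ p : ℕ, p.Prime → #(Ω p) < p) (y : ℕ) :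
    0 ≤ ∏ p ∈ y.primesLE, (1 - #(Ω p) / p : ℝ) :=
  prod_nonneg fun _ hp => sub_nonneg.mpr (card_div_le_one hΩp (Nat.prime_of_mem_primesLE hp))

theorem abs_sum_prod_hit_sub_le_two_pow (hΩ : ∀ p : ℕ, p.Prime → #(Ω p) ≤ 2) (X : ℕ)
    {S : Finset ℕ} (hS : ∀ p ∈ S, p.Prime) :
    |∑ m ∈ range X, ∏ p ∈ S, hit Ω m p - X * ∏ p ∈ S, (#(Ω p) / p : ℝ)| ≤ 2 ^ #S := by
  refine (abs_sum_prod_hit_sub_le Ω X (fun p hp => (hS p hp).pos)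
    fun p hp q hq => (Nat.coprime_primes (hS p hp) (hS q hq)).mpr).trans ?_
  rw [← prod_const]
  exact prod_le_prod (fun _ _ => Nat.cast_nonneg _) fun p hp => by exact_mod_cast hΩ p (hS p hp)

theorem abs_sum_prod_one_sub_hit_sub_le (hΩ : ∀ p : ℕ, p.Prime → #(Ω p) ≤ 2)
    (hΩp : ∀ p : ℕ, p.Prime → #(Ω p) < p) {k y : ℕ} (hk0 : 0 < k) (hk : Even k) (hy : 1 ≤ y)
    (hky : k + 1 ≤ 2 * y) (X : ℕ) :
    |∑ m ∈ range X, ∏ p ∈ y.primesLE, (1 - hit Ω m p) -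
        X * ∏ p ∈ y.primesLE, (1 - #(Ω p) / p : ℝ)| ≤
      (y + 1) * ((k + 2) * ((2 * y : ℝ) ^ (k + 1) / (k + 1)!) * y ^ 16) +
        X * ((∏ p ∈ y.primesLE, (1 - #(Ω p) / p : ℝ)) *
          (sieveSaving k * Real.exp (sieveSaving k))) := by
  have hθ0 (l : ℕ) : 0 ≤ blockError k l := by
    have := blockBound_pos k
    unfold blockError
    positivity
  have hθ := sum_blockError_le hk0 y
  rw [← Fin.sum_univ_eq_sum_range] at hθ
  have hprime : ∀ l : Fin y, ∀ p ∈ primeBlock (k + 4) y l, p.Prime :=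
    fun _ _ => prime_of_mem_primeBlock
  have hsieve := brun_hooley (ι := Fin y) (A := range X) (b := hit Ω) (C := 2)
    (ρ := fun p => (#(Ω p) / p : ℝ)) (s := fun l => primeBlock (k + 4) y l)
    (k := fun l => k * 2 ^ (l : ℕ))
    (fun _ _ hab => pairwise_disjoint_primeBlock _ y fun h => hab (Fin.ext h))
    (fun _ => hk.mul_right _) X.cast_nonneg zero_le_two (hit_nonneg Ω) (hit_le_one Ω)
    (fun _ _ _ => by positivity) (fun l p hp => card_div_le_one hΩp (hprime l p hp))
    (fun S hS => abs_sum_prod_hit_sub_le_two_pow hΩ X fun p hp => by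
      obtain ⟨l, -, hl⟩ := mem_biUnion.mp (hS hp)
      exact hprime l p hl)
    (prod_weightedSum_truncCoef_primeBlock_le hy hky) (fun l => hθ0 l)
    fun l => weightedSum_esymmCoef_primeBlock_le hΩ hΩp k y l _
  simp only [prod_primeBlock (k + 4) y, Fintype.card_fin] at hsieve
  refine hsieve.trans (add_le_add_right ?_ _)
  have := prod_one_sub_card_div_nonneg hΩp y
  have : 0 ≤ ∑ l : Fin y, blockError k l := sum_nonneg fun l _ => hθ0 l
  have := sieveSaving_nonneg k
  gcongr

end FundamentalLemma

section Pairs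

/-- The residue classes modulo `p` of the `m` for which `p` divides `(m + i) * (m + j)`, when `p`
is prime. -/
def pairResidues (i j p : ℕ) : Finset (ZMod p) := {-(i : ZMod p), -(j : ZMod p)}

theorem natCast_mem_pairResidues {i j m p : ℕ} :
    (m : ZMod p) ∈ pairResidues i j p ↔ p ∣ m + i ∨ p ∣ m + j := by
  simp only [pairResidues, mem_insert, mem_singleton, eq_neg_iff_add_eq_zero, ← Nat.cast_add,
    ZMod.natCast_eq_zero_iff]

theorem card_pairResidues (i j p : ℕ) :
    #(pairResidues i j p) = if i ≡ j [MOD p] then 1 else 2 := by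
  split_ifs with h
  · rw [pairResidues, (ZMod.natCast_eq_natCast_iff i j p).mpr h, pair_eq_singleton, card_singleton]
  · exact card_pair fun hneg => h ((ZMod.natCast_eq_natCast_iff i j p).mp (neg_injective hneg))

theorem one_le_card_pairResidues (i j p : ℕ) : 1 ≤ #(pairResidues i j p) :=
  card_pos.mpr (insert_nonempty _ _)

theorem card_pairResidues_le_two (i j p : ℕ) : #(pairResidues i j p) ≤ 2 := card_le_two

theorem card_pairResidues_lt {i j : ℕ} (hij : i ≡ j [MOD 2]) {p : ℕ} (hp : p.Prime) :
    #(pairResidues i j p) < p := by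
  rcases hp.two_le.eq_or_lt with rfl | hp2
  · simp [card_pairResidues, hij]
  · exact (card_pairResidues_le_two i j p).trans_lt hp2

theorem roughInd_eq_prod (y n : ℕ) :
    roughInd y n = ∏ p ∈ y.primesLE, if ¬ p ∣ n then (1 : ℝ) else 0 := by
  have hiff : (∀ p : ℕ, p.Prime → p ∣ n → y < p) ↔ ∀ p ∈ y.primesLE, ¬ p ∣ n :=
    forall_congr' fun p => by rw [Nat.mem_primesLE, ← not_le]; tauto
  simp only [roughInd, hiff, prod_ite_zero, prod_const_one]

theorem roughInd_mul_self (y n : ℕ) : roughInd y n * roughInd y n = roughInd y n := by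
  unfold roughInd; split_ifs <;> simp

theorem prod_one_sub_hit_pairResidues (i j m y : ℕ) :
    ∏ p ∈ y.primesLE, (1 - hit (pairResidues i j) m p) =
      roughInd y (m + i) * roughInd y (m + j) := by
  rw [roughInd_eq_prod, roughInd_eq_prod, ← prod_mul_distrib]
  refine prod_congr rfl fun p _ => ?_
  simp only [hit, natCast_mem_pairResidues]
  by_cases hi : p ∣ m + i <;> by_cases hj : p ∣ m + j <;> simp [hi, hj]

/-- The number of `m < X` such that `m + i` and `m + j` have no prime factor up to `y`. -/
def pairCount (X i j y : ℕ) : ℝ := ∑ m ∈ range X, roughInd y (m + i) * roughInd y (m + j)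

/-- The density of the integers counted by `pairCount`. -/
def pairDensity (i j y : ℕ) : ℝ := ∏ p ∈ y.primesLE, (1 - #(pairResidues i j p) / p : ℝ)

theorem pairCount_eq_zero {y i j : ℕ} (hy : 2 ≤ y) (hij : ¬ i ≡ j [MOD 2]) (X : ℕ) :
    pairCount X i j y = 0 := by
  have h2 : 2 ∈ y.primesLE := Nat.mem_primesLE.mpr ⟨hy, Nat.prime_two⟩
  refine sum_eq_zero fun m _ => ?_
  rw [← prod_one_sub_hit_pairResidues]
  refine prod_eq_zero h2 (sub_eq_zero.mpr (if_pos ?_).symm)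
  rw [natCast_mem_pairResidues]
  unfold Nat.ModEq at hij
  lia

theorem pairDensity_eq_zero {y i j : ℕ} (hy : 2 ≤ y) (hij : ¬ i ≡ j [MOD 2]) :
    pairDensity i j y = 0 := by
  refine prod_eq_zero (Nat.mem_primesLE.mpr ⟨hy, Nat.prime_two⟩) ?_
  rw [card_pairResidues, if_neg hij]
  norm_num

theorem abs_pairCount_sub_le {k y : ℕ} (hk0 : 0 < k) (hk : Even k) (hy : 1 ≤ y)
    (hky : k + 1 ≤ 2 * y) (X : ℕ) {i j : ℕ} (hij : i ≡ j [MOD 2]) :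
    |pairCount X i j y - X * pairDensity i j y| ≤
      (y + 1) * ((k + 2) * ((2 * y : ℝ) ^ (k + 1) / (k + 1)!) * y ^ 16) +
        X * (pairDensity i j y * (sieveSaving k * Real.exp (sieveSaving k))) := by
  simp only [pairCount, ← prod_one_sub_hit_pairResidues]
  exact abs_sum_prod_one_sub_hit_sub_le (fun p _ => card_pairResidues_le_two i j p)
    (fun p hp => card_pairResidues_lt hij hp) hk0 hk hy hky X

theorem roughDensity_eq_prod (y : ℕ) : roughDensity y = ∏ p ∈ y.primesLE, (1 - 1 / p : ℝ) := by
  rw [roughDensity, Nat.primesLE_eq_filter_Icc_one]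

theorem pairDensity_self (i y : ℕ) : pairDensity i i y = roughDensity y := by
  simp only [pairDensity, roughDensity_eq_prod, card_pairResidues, Nat.ModEq.refl, if_true,
    Nat.cast_one]

theorem one_div_natCast_le_one {p : ℕ} : (1 / p : ℝ) ≤ 1 := by
  rw [one_div]; exact Nat.cast_inv_le_one p

theorem roughDensity_nonneg (y : ℕ) : 0 ≤ roughDensity y :=
  prod_nonneg fun _ _ => sub_nonneg.mpr one_div_natCast_le_one

theorem roughDensity_le_one (y : ℕ) : roughDensity y ≤ 1 :=
  prod_le_one (fun _ _ => sub_nonneg.mpr one_div_natCast_le_one)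
    fun p _ => sub_le_self 1 (by positivity)

theorem roughDensity_mul_le_succ (y : ℕ) :
    roughDensity y * (1 - 1 / (y + 1 : ℕ)) ≤ roughDensity (y + 1) := by
  have hIcc : Icc 1 (y + 1) = insert (y + 1) (Icc 1 y) :=
    (insert_Icc_right_eq_Icc_add_one (by lia)).symm
  simp only [roughDensity, hIcc, filter_insert]
  split_ifs
  · rw [prod_insert (by simp), mul_comm]
  · exact mul_le_of_le_one_right (roughDensity_nonneg y) (sub_le_self 1 (by positivity))

theorem one_div_le_roughDensity {y : ℕ} (hy : 1 ≤ y) : 1 / (y : ℝ) ≤ roughDensity y := by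
  induction y, hy using Nat.le_induction with
  | base => simp [roughDensity, filter_singleton, Nat.not_prime_one]
  | succ y hy ih =>
    have : (0 : ℝ) < y := by exact_mod_cast hy
    calc 1 / ((y + 1 : ℕ) : ℝ) = 1 / y * (1 - 1 / (y + 1 : ℕ)) := by push_cast; field_simp; ring
      _ ≤ roughDensity y * (1 - 1 / (y + 1 : ℕ)) :=
        mul_le_mul_of_nonneg_right ih (sub_nonneg.mpr one_div_natCast_le_one)
      _ ≤ roughDensity (y + 1) := roughDensity_mul_le_succ y

theorem pairDensity_le_roughDensity {i j : ℕ} (hij : i ≡ j [MOD 2]) (y : ℕ) :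
    pairDensity i j y ≤ roughDensity y := by
  rw [roughDensity_eq_prod]
  refine prod_le_prod (fun p hp => sub_nonneg.mpr
    (card_div_le_one (fun q => card_pairResidues_lt hij) (Nat.prime_of_mem_primesLE hp)))
    fun p _ => ?_
  have : (1 : ℝ) ≤ #(pairResidues i j p) := by exact_mod_cast one_le_card_pairResidues i j p
  gcongr

theorem sieve_remainder_le {k y X : ℕ} (hy : 2 ≤ y) (hX : y ^ (k + 20) ≤ X) :
    (y + 1) * ((k + 2) * ((2 * y : ℝ) ^ (k + 1) / (k + 1)!) * y ^ 16) ≤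
      X * (roughDensity y * sieveSaving k) := by
  have hy2 : (2 : ℝ) ≤ y := by exact_mod_cast hy
  have hlog : 0 ≤ Real.log (k + 4) := Real.log_nonneg (by linarith [(k.cast_nonneg : (0 : ℝ) ≤ k)])
  have hexp : (k + 2 : ℝ) ≤ Real.exp (4 * blockBound k) := by
    have : Real.log (k + 4) ≤ 4 * blockBound k := by unfold blockBound; linarith
    linarith [(Real.log_le_iff_le_exp (by positivity)).mp this]
  have hpow : (2 : ℝ) ^ (k + 1) ≤ blockBound k ^ (k + 1) := by
    gcongr; unfold blockBound; linarith
  have hsaving : (k + 2 : ℝ) * (2 ^ (k + 1) / (k + 1)!) ≤ sieveSaving k := by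
    unfold sieveSaving; gcongr
  have hlevel : (y + 1 : ℝ) * y ^ (k + 17) ≤ X * roughDensity y :=
    calc (y + 1 : ℝ) * y ^ (k + 17) ≤ y ^ 2 * y ^ (k + 17) := by gcongr; nlinarith
      _ = y ^ (k + 20) * (1 / y) := by field_simp; ring
      _ ≤ X * roughDensity y := by
        gcongr
        · exact_mod_cast hX
        · exact one_div_le_roughDensity (by lia)
  have hP := roughDensity_nonneg y
  calc (y + 1) * ((k + 2) * ((2 * y : ℝ) ^ (k + 1) / (k + 1)!) * y ^ 16)
      = (y + 1) * y ^ (k + 17) * ((k + 2) * (2 ^ (k + 1) / (k + 1)!)) := by rw [mul_pow]; ring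
    _ ≤ X * roughDensity y * sieveSaving k := by gcongr
    _ = X * (roughDensity y * sieveSaving k) := by ring

theorem abs_pairCount_div_sub_le {k y X : ℕ} (hk0 : 0 < k) (hk : Even k) (hy : 2 ≤ y)
    (hky : k + 1 ≤ 2 * y) (hX : y ^ (k + 20) ≤ X) (hs : sieveSaving k ≤ 1) (i j : ℕ) :
    |pairCount X i j y / X - pairDensity i j y| ≤ 4 * (roughDensity y * sieveSaving k) := by
  have hs0 := sieveSaving_nonneg k
  have hP0 := roughDensity_nonneg y
  by_cases hij : i ≡ j [MOD 2]
  swap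
  · rw [pairCount_eq_zero hy hij, pairDensity_eq_zero hy hij, zero_div, sub_zero, abs_zero]
    positivity
  have hX0 : (0 : ℝ) < X := by exact_mod_cast (pow_pos (by lia) (k + 20)).trans_le hX
  have hexp : Real.exp (sieveSaving k) ≤ 3 :=
    (Real.exp_le_exp.mpr hs).trans (by linarith [Real.exp_one_lt_d9])
  have hmain : X * (pairDensity i j y * (sieveSaving k * Real.exp (sieveSaving k))) ≤
      X * (roughDensity y * (sieveSaving k * 3)) := by
    gcongr; exact pairDensity_le_roughDensity hij y
  rw [div_sub' hX0.ne', abs_div, abs_of_pos hX0, div_le_iff₀ hX0]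
  linarith [abs_pairCount_sub_le hk0 hk (by lia) hky X hij, sieve_remainder_le hy hX]

end Pairs

section Variance

theorem roughCount_of_mem_Ico (H y : ℕ) {m : ℕ} {x : ℝ} (hx : x ∈ Set.Ico (m : ℝ) (m + 1)) :
    roughCount H y x = ∑ i ∈ range H, roughInd y (m + (i + 1)) := by
  have hx0 : 0 ≤ x := m.cast_nonneg.trans hx.1
  rw [roughCount, Nat.floor_add_natCast hx0, (Nat.floor_eq_iff hx0).mpr hx, range_eq_Ico,
    sum_Ico_add' (fun n => roughInd y (m + n)), sum_Ico_add (roughInd y)]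
  congr 1
  ext n
  simp only [mem_Ioc, mem_Ico]
  lia

theorem V_eq_sum (X H y : ℕ) : V X H y = 1 / (X : ℝ) * ∑ m ∈ range X,
    (∑ i ∈ range H, roughInd y (m + (i + 1)) - H * roughDensity y) ^ 2 := by
  set F : ℝ → ℝ := fun x => (roughCount H y x - H * roughDensity y) ^ 2
  set c : ℕ → ℝ := fun m => (∑ i ∈ range H, roughInd y (m + (i + 1)) - H * roughDensity y) ^ 2
  have hFc (m : ℕ) : Set.EqOn (fun _ => c m) F (Set.uIoo (m : ℝ) (m + 1 : ℕ)) := by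
    intro x hx
    rw [Set.uIoo_of_le (by push_cast; linarith), Nat.cast_succ] at hx
    simp only [F, c, roughCount_of_mem_Ico H y (Set.Ioo_subset_Ico_self hx)]
  have hF (m : ℕ) : ∫ x in (m : ℝ)..(m + 1 : ℕ), F x = c m := by
    rw [← intervalIntegral.integral_congr_uIoo (hFc m), intervalIntegral.integral_const]
    simp
  rw [V, ← Nat.cast_zero (R := ℝ), ← intervalIntegral.sum_integral_adjacent_intervals
    (a := fun m : ℕ => (m : ℝ)) fun m _ =>
      (intervalIntegrable_const (c := c m)).congr_uIoo (hFc m)]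
  simp only [F, c] at hF ⊢
  simp only [hF]

theorem V_eq_pairCount {X : ℕ} (hX : 0 < X) (H y : ℕ) : V X H y =
    ∑ i ∈ range H, ∑ j ∈ range H, pairCount X (i + 1) (j + 1) y / X -
      2 * (H * roughDensity y) * ∑ i ∈ range H, pairCount X (i + 1) (i + 1) y / X +
      (H * roughDensity y) ^ 2 := by
  have hsq : ∑ m ∈ range X, (∑ i ∈ range H, roughInd y (m + (i + 1))) ^ 2 =
      ∑ i ∈ range H, ∑ j ∈ range H, pairCount X (i + 1) (j + 1) y := by
    simp only [pairCount, pow_two, sum_mul_sum]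
    rw [sum_comm]
    exact sum_congr rfl fun i _ => sum_comm
  have hlin : ∑ m ∈ range X, ∑ i ∈ range H, roughInd y (m + (i + 1)) =
      ∑ i ∈ range H, pairCount X (i + 1) (i + 1) y := by
    simp only [pairCount, roughInd_mul_self]
    exact sum_comm
  have hX0 : (X : ℝ) ≠ 0 := by exact_mod_cast hX.ne'
  rw [V_eq_sum]
  simp only [sub_sq, sum_add_distrib, sum_sub_distrib, ← sum_mul, mul_assoc, ← mul_sum, sum_const,
    card_range, nsmul_eq_mul, hsq, hlin, ← sum_div]
  field_simp

end Variance

section PairDensities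

theorem sum_sum_modEq {q : ℕ} (hq : 0 < q) (H : ℕ) :
    ∑ i ∈ range H, ∑ j ∈ range H, (if i ≡ j [MOD q] then 1 else 0) =
      q * (H / q) ^ 2 + 2 * (H % q) * (H / q) + H % q := by
  induction H with
  | zero => simp
  | succ H ih =>
    have hleft : ∑ i ∈ range H, (if i ≡ H [MOD q] then 1 else 0) = H / q := by
      rw [← card_filter, ← Nat.count_eq_card_filter_range, Nat.count_modEq_card H hq,
        if_neg (lt_irrefl _), add_zero]
    have hright : ∑ i ∈ range H, (if H ≡ i [MOD q] then 1 else 0) = H / q := by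
      simpa only [Nat.ModEq.comm] using hleft
    simp only [sum_range_succ, sum_add_distrib, ih, hleft, hright, Nat.ModEq.refl, if_true]
    have hH := Nat.div_add_mod H q
    rcases (Nat.succ_le_of_lt (Nat.mod_lt H hq)).lt_or_eq with hlt | heq
    · obtain ⟨hdiv, hmod⟩ := (Nat.div_mod_unique hq (a := H + 1) (c := H % q + 1)
        (d := H / q)).mpr ⟨by lia, hlt⟩
      rw [hdiv, hmod]; ring
    · obtain ⟨hdiv, hmod⟩ := (Nat.div_mod_unique hq (a := H + 1) (c := 0)
        (d := H / q + 1)).mpr ⟨by rw [mul_add]; lia, hq⟩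
      rw [hdiv, hmod]
      generalize H / q = N
      generalize H % q = s at heq
      subst heq
      rw [Nat.succ_eq_add_one]; ring

theorem sum_sum_modEq_eq_add_fract {q : ℕ} (hq : 0 < q) (H : ℕ) :
    ∑ i ∈ range H, ∑ j ∈ range H, (if i ≡ j [MOD q] then (1 : ℝ) else 0) =
      q * (Int.fract (H / q : ℝ) * (1 - Int.fract (H / q : ℝ))) + (H : ℝ) ^ 2 / q := by
  have hsum := congrArg (Nat.cast (R := ℝ)) (sum_sum_modEq hq H)
  have hH : (q : ℝ) * (H / q : ℕ) + (H % q : ℕ) = H := by exact_mod_cast Nat.div_add_mod H q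
  have hq0 : (q : ℝ) ≠ 0 := by exact_mod_cast hq.ne'
  push_cast at hsum
  rw [hsum, Int.fract_div_natCast_eq_div_natCast_mod]
  generalize (H / q : ℕ) = N at *
  generalize (H % q : ℕ) = s at *
  rw [← hH]
  field_simp
  ring

theorem modEq_prod_iff {S : Finset ℕ} (hS : ∀ p ∈ S, p.Prime) (i j : ℕ) :
    i ≡ j [MOD ∏ p ∈ S, p] ↔ ∀ p ∈ S, i ≡ j [MOD p] := by
  induction S using Finset.induction_on with
  | empty => simp [Nat.modEq_one]
  | insert q S hq ih =>
    obtain ⟨hqp, hSp⟩ := forall_mem_insert .. |>.mp hS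
    have hcop : q.Coprime (∏ p ∈ S, p) := Nat.coprime_prod_right_iff.mpr fun p hp =>
      (Nat.coprime_primes hqp (hSp p hp)).mpr (ne_of_mem_of_not_mem hp hq).symm
    rw [prod_insert hq, ← Nat.modEq_and_modEq_iff_modEq_mul hcop, ih hSp, forall_mem_insert]

theorem squarefree_prod_of_prime {S : Finset ℕ} (hS : ∀ p ∈ S, p.Prime) :
    Squarefree (∏ p ∈ S, p) :=
  squarefree_prod_of_pairwise_isCoprime (fun p hp q hq hpq => Nat.coprime_iff_isRelPrime.mp
    ((Nat.coprime_primes (hS p hp) (hS q hq)).mpr hpq)) fun p hp => (hS p hp).squarefree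

/-- The odd primes up to `y`. -/
def oddPrimesLE (y : ℕ) : Finset ℕ := (Icc 3 y).filter Nat.Prime

variable {y : ℕ} {S : Finset ℕ}

theorem mem_oddPrimesLE {p : ℕ} : p ∈ oddPrimesLE y ↔ p.Prime ∧ 3 ≤ p ∧ p ≤ y := by
  rw [oddPrimesLE, mem_filter, mem_Icc, and_comm]

theorem three_le_of_mem_oddPrimesLE {p : ℕ} (hp : p ∈ oddPrimesLE y) : (3 : ℝ) ≤ p := by
  exact_mod_cast (mem_oddPrimesLE.mp hp).2.1

theorem prime_of_subset_oddPrimesLE (hS : S ⊆ oddPrimesLE y) : ∀ p ∈ S, p.Prime :=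
  fun _ hp => (mem_oddPrimesLE.mp (hS hp)).1

theorem prod_pos_of_subset_oddPrimesLE (hS : S ⊆ oddPrimesLE y) : 0 < ∏ p ∈ S, p :=
  prod_pos fun p hp => (prime_of_subset_oddPrimesLE hS p hp).pos

theorem two_notMem_oddPrimesLE : 2 ∉ oddPrimesLE y := fun h => by
  have := (mem_oddPrimesLE.mp h).2.1; lia

theorem primesLE_eq_insert (hy : 2 ≤ y) : y.primesLE = insert 2 (oddPrimesLE y) := by
  ext p
  rw [mem_insert, Nat.mem_primesLE, mem_oddPrimesLE]
  constructor
  · rintro ⟨hpy, hp⟩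
    exact hp.two_le.eq_or_lt.imp Eq.symm fun h2 => ⟨hp, h2, hpy⟩
  · rintro (rfl | ⟨hp, -, hpy⟩)
    · exact ⟨hy, Nat.prime_two⟩
    · exact ⟨hpy, hp⟩

theorem prod_primesLE_eq (hy : 2 ≤ y) (f : ℕ → ℝ) :
    ∏ p ∈ y.primesLE, f p = f 2 * ∏ p ∈ oddPrimesLE y, f p := by
  rw [primesLE_eq_insert hy, prod_insert two_notMem_oddPrimesLE]

theorem modEq_two_mul_prod_iff (hS : S ⊆ oddPrimesLE y) (i j : ℕ) :
    i ≡ j [MOD 2 * ∏ p ∈ S, p] ↔ i ≡ j [MOD 2] ∧ ∀ p ∈ S, i ≡ j [MOD p] := by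
  have h2 : 2 ∉ S := fun h => two_notMem_oddPrimesLE (hS h)
  rw [← prod_insert (f := fun p => p) h2, modEq_prod_iff (forall_mem_insert .. |>.mpr
    ⟨Nat.prime_two, prime_of_subset_oddPrimesLE hS⟩), forall_mem_insert]

/-- The product of `1 - 2 / p` over the odd primes `p ≤ y`. -/
def twinDensity (y : ℕ) : ℝ := ∏ p ∈ oddPrimesLE y, (1 - 2 / (p : ℝ))

/-- The weight `∏ p ∈ S, 1 / (p - 2)`; it is `g_y(n) / n` for the product `n` of a set `S` of odd
primes up to `y`. -/
def twinWeight (S : Finset ℕ) : ℝ := ∏ p ∈ S, (1 / ((p : ℝ) - 2))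

theorem twinDensity_nonneg (y : ℕ) : 0 ≤ twinDensity y :=
  prod_nonneg fun p hp => by
    have := three_le_of_mem_oddPrimesLE hp
    rw [sub_nonneg, div_le_one (by linarith)]
    linarith

theorem twinWeight_nonneg (hS : S ⊆ oddPrimesLE y) : 0 ≤ twinWeight S :=
  prod_nonneg fun p hp => one_div_nonneg.mpr (by linarith [three_le_of_mem_oddPrimesLE (hS hp)])

theorem prod_div_sub_two_eq (S : Finset ℕ) :
    ∏ p ∈ S, ((p : ℝ) / (p - 2)) = twinWeight S * (∏ p ∈ S, p : ℕ) := by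
  rw [twinWeight, Nat.cast_prod, ← prod_mul_distrib]
  exact prod_congr rfl fun p _ => (one_div_mul_eq_div ..).symm

theorem prod_oddPrimesLE_one_sub_card_div (y i j : ℕ) :
    ∏ p ∈ oddPrimesLE y, (1 - #(pairResidues i j p) / p : ℝ) = twinDensity y *
      ∑ S ∈ (oddPrimesLE y).powerset,
        twinWeight S * (if ∀ p ∈ S, i ≡ j [MOD p] then 1 else 0) := by
  have hterm (S : Finset ℕ) : twinWeight S * (if ∀ p ∈ S, i ≡ j [MOD p] then 1 else 0) =
      ∏ p ∈ S, (1 / ((p : ℝ) - 2) * if i ≡ j [MOD p] then 1 else 0) := by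
    rw [prod_mul_distrib, prod_ite_zero, prod_const_one, twinWeight]
  simp only [hterm]
  rw [← prod_one_add, twinDensity, ← prod_mul_distrib]
  refine prod_congr rfl fun p hp => ?_
  have hp3 := three_le_of_mem_oddPrimesLE hp
  have : (p : ℝ) ≠ 0 := by linarith
  have : (p : ℝ) - 2 ≠ 0 := by linarith
  rw [card_pairResidues]
  split_ifs
  · push_cast; field_simp; ring
  · simp

theorem pairDensity_eq_sum (hy : 2 ≤ y) (i j : ℕ) : pairDensity i j y =
    1 / 2 * twinDensity y * ∑ S ∈ (oddPrimesLE y).powerset,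
      twinWeight S * (if i ≡ j [MOD 2 * ∏ p ∈ S, p] then 1 else 0) := by
  rw [pairDensity, prod_primesLE_eq hy, prod_oddPrimesLE_one_sub_card_div, card_pairResidues,
    ← mul_assoc]
  by_cases h2 : i ≡ j [MOD 2]
  · rw [if_pos h2, (by norm_num : 1 - ((1 : ℕ) : ℝ) / (2 : ℕ) = 1 / 2)]
    refine congrArg _ (sum_congr rfl fun S hS => ?_)
    simp only [modEq_two_mul_prod_iff (mem_powerset.mp hS), h2, true_and]
  · rw [if_neg h2, (by norm_num : 1 - ((2 : ℕ) : ℝ) / (2 : ℕ) = 0), zero_mul, zero_mul]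
    refine (mul_eq_zero_of_right _ (sum_eq_zero fun S hS => ?_)).symm
    simp only [modEq_two_mul_prod_iff (mem_powerset.mp hS), h2, false_and, if_false, mul_zero]

theorem g_prod_eq (hS : S ⊆ oddPrimesLE y) :
    g y (∏ p ∈ S, p) = twinWeight S * (∏ p ∈ S, p : ℕ) := by
  have hprime := prime_of_subset_oddPrimesLE hS
  rw [g, if_pos (squarefree_prod_of_prime hprime), Nat.primeFactors_prod hprime,
    ← prod_div_sub_two_eq]
  exact prod_congr rfl fun p hp => if_pos (mem_oddPrimesLE.mp (hS hp)).2

theorem exists_eq_prod_of_g_ne_zero {n : ℕ} (hn : g y n ≠ 0) :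
    ∃ S ∈ (oddPrimesLE y).powerset, ∏ p ∈ S, p = n := by
  unfold g at hn
  split_ifs at hn with hsq
  · refine ⟨n.primeFactors, mem_powerset.mpr fun p hp => ?_,
      Nat.prod_primeFactors_of_squarefree hsq⟩
    have hgp := prod_ne_zero_iff.mp hn p hp
    unfold gPrime at hgp
    split_ifs at hgp with hpy
    · exact mem_oddPrimesLE.mpr ⟨Nat.prime_of_mem_primeFactors hp, hpy⟩
    · exact absurd rfl hgp
  · exact absurd rfl hn

theorem tsum_g_mul (y : ℕ) (F : ℕ → ℝ) : ∑' n : ℕ, g y n * F n =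
    ∑ S ∈ (oddPrimesLE y).powerset, twinWeight S * ((∏ p ∈ S, p : ℕ) * F (∏ p ∈ S, p)) := by
  rw [tsum_eq_sum (s := (oddPrimesLE y).powerset.image fun S => ∏ p ∈ S, p), sum_image]
  · refine sum_congr rfl fun S hS => ?_
    rw [g_prod_eq (mem_powerset.mp hS), mul_assoc]
  · intro S hS S' hS' (hSS' : ∏ p ∈ S, p = ∏ p ∈ S', p)
    have hprime {T : Finset ℕ} (hT : T ∈ (oddPrimesLE y).powerset) :=
      prime_of_subset_oddPrimesLE (mem_powerset.mp hT)
    rw [← Nat.primeFactors_prod (hprime hS), hSS', Nat.primeFactors_prod (hprime hS')]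
  · intro n hn
    by_contra hne
    exact hn (mem_image.mpr (exists_eq_prod_of_g_ne_zero (left_ne_zero_of_mul hne)))

/-- The summand of `M H y` at `n`, without the factor `g_y(n) / n`. -/
def fractTerm (H n : ℕ) : ℝ :=
  n * (Int.fract ((H : ℝ) / (2 * n)) * (1 - Int.fract ((H : ℝ) / (2 * n))))

theorem fractTerm_nonneg (H n : ℕ) : 0 ≤ fractTerm H n :=
  mul_nonneg n.cast_nonneg
    (mul_nonneg (Int.fract_nonneg _) (sub_nonneg.mpr (Int.fract_lt_one _).le))

theorem M_eq_sum (H y : ℕ) : M H y =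
    twinDensity y * ∑ S ∈ (oddPrimesLE y).powerset, twinWeight S * fractTerm H (∏ p ∈ S, p) := by
  simp only [M, mul_assoc, tsum_g_mul y fun n : ℕ => Int.fract ((H : ℝ) / (2 * (n : ℝ))) *
    (1 - Int.fract ((H : ℝ) / (2 * (n : ℝ)))), fractTerm, twinDensity, oddPrimesLE]

theorem roughDensity_eq_half_mul (hy : 2 ≤ y) :
    roughDensity y = 1 / 2 * ∏ p ∈ oddPrimesLE y, (1 - 1 / (p : ℝ)) := by
  rw [roughDensity_eq_prod, prod_primesLE_eq hy]
  norm_num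

theorem twinDensity_mul_sum_twinWeight_div (hy : 2 ≤ y) :
    twinDensity y * ∑ S ∈ (oddPrimesLE y).powerset, twinWeight S / (∏ p ∈ S, p : ℕ) =
      (2 * roughDensity y) ^ 2 := by
  have hterm (S : Finset ℕ) :
      twinWeight S / (∏ p ∈ S, p : ℕ) = ∏ p ∈ S, (1 / ((p : ℝ) - 2) / p) := by
    rw [twinWeight, Nat.cast_prod, ← prod_div_distrib]
  simp only [hterm]
  rw [← prod_one_add, roughDensity_eq_half_mul hy, ← mul_assoc, mul_one_div_cancel two_ne_zero,
    one_mul, twinDensity, ← prod_mul_distrib, ← prod_pow]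
  refine prod_congr rfl fun p hp => ?_
  have hp3 := three_le_of_mem_oddPrimesLE hp
  have : (p : ℝ) ≠ 0 := by linarith
  have : (p : ℝ) - 2 ≠ 0 := by linarith
  field_simp
  ring

theorem sum_sum_pairDensity (hy : 2 ≤ y) (H : ℕ) :
    ∑ i ∈ range H, ∑ j ∈ range H, pairDensity (i + 1) (j + 1) y =
      M H y + (H * roughDensity y) ^ 2 := by
  have hshift (q i j : ℕ) : i + 1 ≡ j + 1 [MOD q] ↔ i ≡ j [MOD q] :=
    ⟨Nat.ModEq.add_right_cancel' 1, Nat.ModEq.add_right 1⟩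
  have hcount : ∀ S ∈ (oddPrimesLE y).powerset, ∑ i ∈ range H, ∑ j ∈ range H,
      twinWeight S * (if i ≡ j [MOD 2 * ∏ p ∈ S, p] then (1 : ℝ) else 0) =
      2 * (twinWeight S * fractTerm H (∏ p ∈ S, p)) +
        (H : ℝ) ^ 2 / 2 * (twinWeight S / (∏ p ∈ S, p : ℕ)) := fun S hS => by
    have hpos := prod_pos_of_subset_oddPrimesLE (mem_powerset.mp hS)
    simp only [← mul_sum, fractTerm]
    rw [sum_sum_modEq_eq_add_fract (mul_pos two_pos hpos), Nat.cast_mul, Nat.cast_ofNat]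
    ring
  simp only [pairDensity_eq_sum hy, hshift, ← mul_sum]
  rw [sum_congr rfl fun i _ => sum_comm, sum_comm, sum_congr rfl hcount, sum_add_distrib,
    ← mul_sum, ← mul_sum, M_eq_sum]
  linear_combination (H ^ 2 / 4 : ℝ) * twinDensity_mul_sum_twinWeight_div hy

theorem V_sub_M_eq {X : ℕ} (hX : 0 < X) (hy : 2 ≤ y) (H : ℕ) : V X H y - M H y =
    ∑ i ∈ range H, ∑ j ∈ range H,
        (pairCount X (i + 1) (j + 1) y / X - pairDensity (i + 1) (j + 1) y) -
      2 * (H * roughDensity y) * ∑ i ∈ range H,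
        (pairCount X (i + 1) (i + 1) y / X - pairDensity (i + 1) (i + 1) y) := by
  rw [V_eq_pairCount hX]
  simp only [sum_sub_distrib, sum_sum_pairDensity hy H, pairDensity_self, sum_const, card_range,
    nsmul_eq_mul]
  ring

theorem abs_V_sub_M_le {X : ℕ} (hX : 0 < X) (hy : 2 ≤ y) (H : ℕ) {E : ℝ}
    (hE : ∀ i j, |pairCount X i j y / X - pairDensity i j y| ≤ E) :
    |V X H y - M H y| ≤ 3 * H ^ 2 * E := by
  have hsum {f : ℕ → ℝ} {B : ℝ} (hf : ∀ i, |f i| ≤ B) : |∑ i ∈ range H, f i| ≤ H * B := by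
    refine (abs_sum_le_sum_abs _ _).trans ((sum_le_card_nsmul _ _ B fun i _ => hf i).trans_eq ?_)
    rw [card_range, nsmul_eq_mul]
  have hE0 : 0 ≤ E := (abs_nonneg _).trans (hE 0 0)
  have hP0 := roughDensity_nonneg y
  rw [V_sub_M_eq hX hy]
  calc _ ≤ H * (H * E) + 2 * (H * roughDensity y) * (H * E) := by
        refine (abs_sub _ _).trans (add_le_add (hsum fun i => hsum fun j => hE _ _) ?_)
        rw [abs_mul, abs_of_nonneg (by positivity : 0 ≤ 2 * (H * roughDensity y))]
        gcongr
        exact hsum fun i => hE _ _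
    _ ≤ H * (H * E) + 2 * (H * 1) * (H * E) := by gcongr; exact roughDensity_le_one y
    _ = 3 * H ^ 2 * E := by ring

end PairDensities

section SieveSaving

theorem eventually_log_le_mul {η : ℝ} (hη : 0 < η) : ∀ᶠ t : ℝ in atTop, Real.log t ≤ η * t := by
  filter_upwards [Real.isLittleO_log_id_atTop.bound hη, eventually_ge_atTop 1] with t hlog ht
  rwa [id, Real.norm_of_nonneg (Real.log_nonneg ht),
    Real.norm_of_nonneg (zero_le_one.trans ht)] at hlog

theorem eventually_mul_log_le_rpow {C η : ℝ} (hC : 0 < C) (hη : 0 < η) :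
    ∀ᶠ x : ℝ in atTop, C * Real.log x ≤ x ^ η := by
  filter_upwards [(isLittleO_log_rpow_atTop hη).bound (inv_pos.mpr hC),
    eventually_ge_atTop 1] with x hlog hx
  rwa [Real.norm_of_nonneg (Real.log_nonneg hx), Real.norm_of_nonneg (by positivity),
    le_inv_mul_iff₀ hC] at hlog

theorem blockBound_le_mul_log {k : ℕ} (hk : 8 ≤ k) : blockBound k ≤ 32 * Real.log k := by
  have hk8 : (8 : ℝ) ≤ k := by exact_mod_cast hk
  have hadd : Real.log (k + 4) ≤ Real.log 2 + Real.log k := by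
    rw [← Real.log_mul two_ne_zero (by positivity)]
    exact Real.log_le_log (by positivity) (by linarith)
  have h8 : 3 * Real.log 2 ≤ Real.log k := by
    rw [← Nat.cast_ofNat (n := 3), ← Real.log_pow]
    exact Real.log_le_log (by positivity) (by linarith)
  unfold blockBound
  linarith [Real.log_two_gt_d9]

theorem sieveSaving_le_exp {k : ℕ} (hk : 0 < k) : sieveSaving k ≤
    Real.exp (4 * blockBound k + (k + 1) * (Real.log (blockBound k) + 1 - Real.log k)) := by
  have hΛ := blockBound_pos k
  set Λ := blockBound k
  have hk0 : (0 : ℝ) < k := by exact_mod_cast hk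
  have hpow : (Λ / k) ^ (k + 1) = Real.exp ((k + 1) * (Real.log Λ - Real.log k)) := by
    rw [← Real.log_div hΛ.ne' hk0.ne', ← Real.exp_log (div_pos hΛ hk0), ← Real.exp_nat_mul,
      Real.log_exp, Nat.cast_succ]
  have hterm : Λ ^ (k + 1) / (k + 1)! ≤
      Real.exp ((k + 1) * (Real.log Λ + 1 - Real.log k)) := by
    calc Λ ^ (k + 1) / (k + 1)!
        = (Λ / (k + 1)) ^ (k + 1) * ((k + 1 : ℝ) ^ (k + 1) / (k + 1)!) := by
          rw [div_pow]; field_simp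
      _ ≤ (Λ / k) ^ (k + 1) * Real.exp (k + 1) := by
          gcongr
          · linarith
          · exact Real.pow_div_factorial_le_exp _ (by positivity) _
      _ = Real.exp ((k + 1) * (Real.log Λ + 1 - Real.log k)) := by
          rw [hpow, ← Real.exp_add]; ring_nf
  rw [sieveSaving, Real.exp_add]
  gcongr

theorem eventually_sieveSaving_le {η : ℝ} (hη : 0 < η) :
    ∀ᶠ k : ℕ in atTop, sieveSaving k ≤ Real.exp (-((1 - η) * (k * Real.log k))) := by
  have hcast := tendsto_natCast_atTop_atTop (R := ℝ)
  have hr : 0 < min (η / 2) 1 := by positivity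
  filter_upwards [eventually_ge_atTop 8, hcast.eventually_ge_atTop (256 / η), hcast.eventually
    (eventually_mul_log_le_rpow (C := 32 * Real.exp 1) (by positivity) hr)] with k hk8 hkη hrpow
  have hΛ := blockBound_pos k
  have hΛlog := blockBound_le_mul_log hk8
  have hlog : 0 ≤ Real.log k := by linarith
  have hlogΛ : Real.log (blockBound k) + 1 ≤ min (η / 2) 1 * Real.log k := by
    have hk0 : (0 : ℝ) < k := by exact_mod_cast (by lia : 0 < k)
    rw [← Real.log_rpow hk0, ← Real.log_exp 1, ← Real.log_mul hΛ.ne' (Real.exp_pos 1).ne',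
      Real.log_exp]
    refine Real.log_le_log (by positivity) (le_trans ?_ hrpow)
    rw [mul_right_comm]
    exact mul_le_mul_of_nonneg_right hΛlog (Real.exp_pos 1).le
  have hΛk : 4 * blockBound k ≤ η / 2 * k * Real.log k := by
    have : 256 ≤ k * η := (div_le_iff₀ hη).mp hkη
    nlinarith
  have hneg : Real.log (blockBound k) + 1 - Real.log k ≤ 0 := by
    nlinarith [min_le_right (η / 2) 1]
  have hmain : (k + 1) * (Real.log (blockBound k) + 1 - Real.log k) ≤
      k * (η / 2 * Real.log k - Real.log k) :=
    calc (k + 1) * (Real.log (blockBound k) + 1 - Real.log k)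
        ≤ k * (Real.log (blockBound k) + 1 - Real.log k) := by linarith
      _ ≤ k * (η / 2 * Real.log k - Real.log k) := by
          gcongr
          exact hlogΛ.trans (mul_le_mul_of_nonneg_right (min_le_left _ _) hlog)
  refine (sieveSaving_le_exp (by lia)).trans (Real.exp_le_exp.mpr ?_)
  linarith

end SieveSaving

section LowerBound

variable {H y : ℕ}

/-- The sum of `twinWeight S` over the sets `S` of odd primes up to `y` with product at least
`H`. -/
def tailSum (H y : ℕ) : ℝ :=
  ∑ S ∈ (oddPrimesLE y).powerset with H ≤ ∏ p ∈ S, p, twinWeight S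

theorem div_four_le_fractTerm {n : ℕ} (hHn : H ≤ n) : (H / 4 : ℝ) ≤ fractTerm H n := by
  rcases n.eq_zero_or_pos with rfl | hn
  · simp [fractTerm, Nat.le_zero.mp hHn]
  have : (0 : ℝ) < n := by exact_mod_cast hn
  have hle : (H : ℝ) / (2 * n) ≤ 1 / 2 := by
    rw [div_le_div_iff₀ (by positivity) two_pos]
    linarith [(Nat.cast_le (α := ℝ)).mpr hHn]
  have hfract : Int.fract ((H : ℝ) / (2 * n)) = H / (2 * n) :=
    Int.fract_eq_self.mpr ⟨by positivity, by linarith⟩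
  rw [fractTerm, hfract]
  calc (H / 4 : ℝ) = H / 2 * (1 - 1 / 2) := by ring
    _ ≤ H / 2 * (1 - H / (2 * n)) := by gcongr
    _ = n * (H / (2 * n) * (1 - H / (2 * n))) := by field_simp

theorem mul_twinDensity_mul_tailSum_le_M (H y : ℕ) :
    H / 4 * (twinDensity y * tailSum H y) ≤ M H y := by
  rw [M_eq_sum, mul_left_comm, tailSum, mul_sum]
  refine mul_le_mul_of_nonneg_left ?_ (twinDensity_nonneg y)
  calc ∑ S ∈ (oddPrimesLE y).powerset with H ≤ ∏ p ∈ S, p, (H / 4 : ℝ) * twinWeight S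
      ≤ ∑ S ∈ (oddPrimesLE y).powerset with H ≤ ∏ p ∈ S, p,
          twinWeight S * fractTerm H (∏ p ∈ S, p) := by
        refine sum_le_sum fun S hS => ?_
        obtain ⟨hS, hHS⟩ := mem_filter.mp hS
        rw [mul_comm]
        exact mul_le_mul_of_nonneg_left (div_four_le_fractTerm hHS)
          (twinWeight_nonneg (mem_powerset.mp hS))
    _ ≤ ∑ S ∈ (oddPrimesLE y).powerset, twinWeight S * fractTerm H (∏ p ∈ S, p) :=
        sum_le_sum_of_subset_of_nonneg (filter_subset _ _) fun S hS _ =>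
          mul_nonneg (twinWeight_nonneg (mem_powerset.mp hS)) (fractTerm_nonneg _ _)

theorem choose_mul_le_tailSum {K : ℕ} {z : ℝ} (hz : 0 ≤ z) (hHz : H ≤ z ^ K) {A : Finset ℕ}
    (hA : A ⊆ oddPrimesLE y) (hAz : ∀ p ∈ A, z ≤ p) :
    (#A).choose K * (1 / y : ℝ) ^ K ≤ tailSum H y := by
  have hsub : A.powersetCard K ⊆ {S ∈ (oddPrimesLE y).powerset | H ≤ ∏ p ∈ S, p} := by
    intro S hS
    obtain ⟨hSA, rfl⟩ := mem_powersetCard.mp hS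
    refine mem_filter.mpr ⟨mem_powerset.mpr (hSA.trans hA), ?_⟩
    rw [← Nat.cast_le (α := ℝ), Nat.cast_prod]
    refine hHz.trans ?_
    rw [← prod_const]
    exact prod_le_prod (fun _ _ => hz) fun p hp => hAz p (hSA hp)
  have hweight : ∀ S ∈ A.powersetCard K, (1 / y : ℝ) ^ K ≤ twinWeight S := by
    intro S hS
    obtain ⟨hSA, rfl⟩ := mem_powersetCard.mp hS
    rw [← prod_const]
    refine prod_le_prod (fun _ _ => by positivity) fun p hp => ?_
    have hp3 := three_le_of_mem_oddPrimesLE (hA (hSA hp))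
    have hpy : (p : ℝ) ≤ y := by exact_mod_cast (mem_oddPrimesLE.mp (hA (hSA hp))).2.2
    exact one_div_le_one_div_of_le (by linarith) (by linarith)
  calc ((#A).choose K * (1 / y : ℝ) ^ K) ≤ ∑ S ∈ A.powersetCard K, twinWeight S := by
        rw [← card_powersetCard, ← nsmul_eq_mul]
        exact card_nsmul_le_sum _ _ _ hweight
    _ ≤ tailSum H y := sum_le_sum_of_subset_of_nonneg hsub fun S hS _ =>
        twinWeight_nonneg (mem_powerset.mp (mem_filter.mp hS).1)

theorem sum_powerset_twinWeight (T : Finset ℕ) :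
    ∑ S ∈ T.powerset, twinWeight S = ∏ p ∈ T, (1 + 1 / ((p : ℝ) - 2)) :=
  (prod_one_add T).symm

theorem twinDensity_mul_prod_one_add (hy : 2 ≤ y) :
    twinDensity y * ∏ p ∈ oddPrimesLE y, (1 + 1 / ((p : ℝ) - 2)) = 2 * roughDensity y := by
  rw [roughDensity_eq_half_mul hy, twinDensity, ← prod_mul_distrib, ← mul_assoc,
    mul_one_div_cancel two_ne_zero, one_mul]
  refine prod_congr rfl fun p hp => ?_
  have := three_le_of_mem_oddPrimesLE hp
  have : (p : ℝ) ≠ 0 := by linarith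
  have : (p : ℝ) - 2 ≠ 0 := by linarith
  field_simp
  ring

theorem one_add_sum_le_prod_one_add {s : Finset ℕ} {f : ℕ → ℝ} (hf : ∀ i ∈ s, 0 ≤ f i) :
    1 + ∑ i ∈ s, f i ≤ ∏ i ∈ s, (1 + f i) := by
  induction s using Finset.induction_on with
  | empty => simp
  | insert a s ha ih =>
    obtain ⟨hfa, hfs⟩ := forall_mem_insert .. |>.mp hf
    rw [sum_insert ha, prod_insert ha]
    nlinarith [ih hfs, sum_nonneg hfs]

theorem prod_sub_prod_sdiff_le_tailSum {B : Finset ℕ} (hBH : ∀ p ∈ B, H ≤ p) :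
    ∏ p ∈ oddPrimesLE y, (1 + 1 / ((p : ℝ) - 2)) -
      ∏ p ∈ oddPrimesLE y \ B, (1 + 1 / ((p : ℝ) - 2)) ≤ tailSum H y := by
  rw [← sum_powerset_twinWeight, ← sum_powerset_twinWeight, tailSum, sub_le_iff_le_add,
    ← sum_filter_add_sum_filter_not _ (fun S : Finset ℕ => H ≤ ∏ p ∈ S, p), add_le_add_iff_left]
  refine sum_le_sum_of_subset_of_nonneg (fun S hS => ?_) fun S hS _ =>
    twinWeight_nonneg ((mem_powerset.mp hS).trans sdiff_subset)
  obtain ⟨hS, hlt⟩ := mem_filter.mp hS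
  have hSy := mem_powerset.mp hS
  refine mem_powerset.mpr fun p hp => mem_sdiff.mpr ⟨hSy hp, fun hpB => hlt ?_⟩
  exact (hBH p hpB).trans
    (Nat.le_of_dvd (prod_pos_of_subset_oddPrimesLE hSy) (dvd_prod_of_mem _ hp))

theorem roughDensity_mul_le_twinDensity_mul_tailSum (hy : 2 ≤ y) {B : Finset ℕ}
    (hB : B ⊆ oddPrimesLE y) (hBH : ∀ p ∈ B, H ≤ p) {t : ℝ} (ht0 : 0 ≤ t) (ht1 : t ≤ 1)
    (ht : t ≤ ∑ p ∈ B, (1 / p : ℝ)) :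
    roughDensity y * t ≤ twinDensity y * tailSum H y := by
  have hnonneg : ∀ p ∈ oddPrimesLE y, 0 ≤ 1 / ((p : ℝ) - 2) := fun p hp =>
    one_div_nonneg.mpr (by linarith [three_le_of_mem_oddPrimesLE hp])
  set P := ∏ p ∈ oddPrimesLE y, (1 + 1 / ((p : ℝ) - 2)) with hP
  set R := ∏ p ∈ oddPrimesLE y \ B, (1 + 1 / ((p : ℝ) - 2)) with hR
  have hR0 : 0 ≤ R :=
    prod_nonneg fun p hp => add_nonneg zero_le_one (hnonneg p (sdiff_subset hp))
  have hRP : R * (1 + t) ≤ P := by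
    rw [hP, ← prod_sdiff hB]
    refine mul_le_mul_of_nonneg_left ?_ hR0
    refine le_trans ?_ (one_add_sum_le_prod_one_add fun p hp => hnonneg p (hB hp))
    refine add_le_add_right (ht.trans (sum_le_sum fun p hp => ?_)) 1
    have := three_le_of_mem_oddPrimesLE (hB hp)
    exact one_div_le_one_div_of_le (by linarith) (by linarith)
  have htail : P * (t / 2) ≤ tailSum H y := by
    refine le_trans ?_ (prod_sub_prod_sdiff_le_tailSum hBH)
    rw [← hP, ← hR]
    nlinarith [mul_le_mul_of_nonneg_right hRP (by linarith : 0 ≤ 1 - t / 2),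
      mul_nonneg hR0 (mul_nonneg ht0 (sub_nonneg.mpr ht1))]
  calc roughDensity y * t = twinDensity y * (P * (t / 2)) := by
        rw [← mul_assoc, twinDensity_mul_prod_one_add hy]; ring
    _ ≤ twinDensity y * tailSum H y := mul_le_mul_of_nonneg_left htail (twinDensity_nonneg y)

end LowerBound

section MainTermAsymptotics

theorem exp_neg_le_twinDensity {y : ℕ} (hy : 2 ≤ y) :
    Real.exp (-(48 * (1 + Real.log (3 * Real.log y)))) ≤ twinDensity y := by
  have hlog2 : Real.log 2 ≤ Real.log y := Real.log_le_log two_pos (by exact_mod_cast hy)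
  have hnatLog : ((Nat.log 2 y + 1 : ℕ) : ℝ) ≤ 3 * Real.log y := by
    have := Real.natLog_le_logb y 2
    rw [Nat.cast_ofNat, Real.logb, le_div_iff₀ (Real.log_pos one_lt_two)] at this
    push_cast
    nlinarith [Real.log_two_gt_d9]
  have hsum := sum_inv_primes_le (T := Nat.log 2 y + 1) (Nat.succ_pos _) (s := oddPrimesLE y)
    (fun p hp => (mem_oddPrimesLE.mp hp).1) fun p hp q hq =>
      calc q ≤ y := (mem_oddPrimesLE.mp hq).2.2
        _ < 2 ^ (Nat.log 2 y + 1) := Nat.lt_pow_succ_log_self one_lt_two y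
        _ ≤ p ^ (Nat.log 2 y + 1) :=
          Nat.pow_le_pow_left (mem_oddPrimesLE.mp hp).1.two_le _
  refine le_trans (Real.exp_le_exp.mpr ?_) (exp_neg_sum_le_prod_one_sub (c := fun _ => 2)
    (fun _ _ => le_rfl) fun p hp => (mem_oddPrimesLE.mp hp).2.1)
  linarith [Real.log_le_log (by positivity) hnatLog]

theorem eventually_rpow_neg_le_twinDensity {η : ℝ} (hη : 0 < η) :
    ∀ᶠ H : ℕ in atTop, ∀ y, 2 ≤ y → y ≤ H ^ 2 → (H : ℝ) ^ (-η) ≤ twinDensity y := by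
  have hlogH := Real.tendsto_log_atTop.comp (tendsto_natCast_atTop_atTop (R := ℝ))
  filter_upwards [eventually_gt_atTop 0, hlogH.eventually_ge_atTop (96 / η),
    (hlogH.const_mul_atTop (by norm_num : (0 : ℝ) < 6)).eventually
      (eventually_log_le_mul (by positivity : 0 < η / 576))] with H hH0 hH hloglog y hy hyH
  have hy0 : 0 < Real.log y := Real.log_pos (by exact_mod_cast hy)
  have hlog : Real.log y ≤ 2 * Real.log H := by
    rw [← Nat.cast_ofNat (n := 2), ← Real.log_pow]
    exact Real.log_le_log (by positivity) (by exact_mod_cast hyH)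
  have hlog3 : Real.log (3 * Real.log y) ≤ Real.log (6 * Real.log H) :=
    Real.log_le_log (by positivity) (by linarith)
  have hHη : 96 ≤ Real.log H * η := (div_le_iff₀ hη).mp hH
  dsimp only [Function.comp] at hloglog
  rw [Real.rpow_def_of_pos (by exact_mod_cast hH0)]
  refine (Real.exp_le_exp.mpr ?_).trans (exp_neg_le_twinDensity hy)
  linarith

theorem eventually_div_log_le_primeCounting :
    ∀ᶠ n : ℕ in atTop, (n : ℝ) / (2 * Real.log n) ≤ (Nat.primeCounting n : ℝ) := by
  filter_upwards [tendsto_natCast_atTop_atTop (R := ℝ) |>.eventually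
    (eventually_log_le_mul (by norm_num : (0 : ℝ) < 1 / 20)), eventually_ge_atTop 20] with n hlog hn
  have hn20 : (20 : ℝ) ≤ n := by exact_mod_cast hn
  have hlog0 : 0 < Real.log n := Real.log_pos (by linarith)
  have hlog1 : Real.log (n + 1) ≤ Real.log 2 + Real.log n := by
    rw [← Real.log_mul two_ne_zero (by positivity)]
    exact Real.log_le_log (by linarith) (by linarith)
  refine le_trans ?_ (Chebyshev.pi_ge n)
  rw [← div_div, div_le_div_iff_of_pos_right hlog0]
  nlinarith [Real.log_two_gt_d9, Real.log_two_lt_d9]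

/-- The odd primes `p` with `z < p ≤ y`. -/
def oddPrimesIoc (z : ℝ) (y : ℕ) : Finset ℕ := (oddPrimesLE y).filter fun p : ℕ => z < p

theorem mem_oddPrimesIoc {z : ℝ} {y p : ℕ} :
    p ∈ oddPrimesIoc z y ↔ p ∈ oddPrimesLE y ∧ z < p := mem_filter

theorem primeCounting_le_card_add {n : ℕ} {z : ℝ} (hz : 2 ≤ z) :
    (Nat.primeCounting n : ℝ) ≤ #(oddPrimesIoc z n) + z := by
  have hsub : n.primesLE ⊆ oddPrimesIoc z n ∪ Icc 1 ⌊z⌋₊ := by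
    intro p hp
    obtain ⟨hpn, hpp⟩ := Nat.mem_primesLE.mp hp
    rw [mem_union, mem_oddPrimesIoc, mem_Icc, mem_oddPrimesLE]
    rcases lt_or_ge z p with hzp | hpz
    · exact Or.inl ⟨⟨hpp, by exact_mod_cast hz.trans_lt hzp, hpn⟩, hzp⟩
    · exact Or.inr ⟨hpp.one_le, Nat.le_floor hpz⟩
  have hcard := (card_le_card hsub).trans (card_union_le _ _)
  rw [Nat.primesLE_card_eq_primeCounting, Nat.card_Icc, Nat.add_sub_cancel] at hcard
  calc (Nat.primeCounting n : ℝ) ≤ #(oddPrimesIoc z n) + (⌊z⌋₊ : ℝ) := by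
        exact_mod_cast hcard
    _ ≤ #(oddPrimesIoc z n) + z := by
        gcongr
        exact Nat.floor_le (by linarith)

theorem eventually_div_log_le_sum_inv_primes : ∀ᶠ H : ℕ in atTop,
    1 / (8 * Real.log H) ≤ ∑ p ∈ oddPrimesIoc H (H ^ 2), (1 / p : ℝ) := by
  have hcast := tendsto_natCast_atTop_atTop (R := ℝ)
  filter_upwards [eventually_ge_atTop 2, hcast.eventually
      (eventually_log_le_mul (by norm_num : (0 : ℝ) < 1 / 8)),
    (tendsto_pow_atTop two_ne_zero).eventually eventually_div_log_le_primeCounting]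
    with H hH hlog hπ
  have hH2 : (2 : ℝ) ≤ H := by exact_mod_cast hH
  have hlog0 : 0 < Real.log H := Real.log_pos (by linarith)
  have hcard := hπ.trans (primeCounting_le_card_add hH2)
  rw [Nat.cast_pow, Real.log_pow, div_le_iff₀ (by positivity), Nat.cast_ofNat] at hcard
  calc 1 / (8 * Real.log H) ≤ #(oddPrimesIoc H (H ^ 2)) * (1 / (H : ℝ) ^ 2) := by
        rw [mul_one_div, div_le_div_iff₀ (by positivity) (by positivity)]
        nlinarith
    _ ≤ ∑ p ∈ oddPrimesIoc H (H ^ 2), (1 / p : ℝ) := by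
        rw [← nsmul_eq_mul]
        refine card_nsmul_le_sum _ _ _ fun p hp => ?_
        obtain ⟨hpp, -, hpH⟩ := mem_oddPrimesLE.mp (mem_oddPrimesIoc.mp hp).1
        exact one_div_le_one_div_of_le (by exact_mod_cast hpp.pos) (by exact_mod_cast hpH)

theorem eventually_le_M_of_sq_lt {κ : ℝ} (hκ : 0 < κ) : ∀ᶠ H : ℕ in atTop,
    ∀ y, H ^ 2 < y → roughDensity y * (H : ℝ) ^ (1 - κ) ≤ M H y := by
  have hcast := tendsto_natCast_atTop_atTop (R := ℝ)
  filter_upwards [eventually_ge_atTop 2, eventually_div_log_le_sum_inv_primes,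
    (Real.tendsto_log_atTop.comp hcast).eventually_ge_atTop 1,
    hcast.eventually (eventually_mul_log_le_rpow (by norm_num : (0 : ℝ) < 32) hκ)]
    with H hH hsum hlog hrpow y hHy
  have hH0 : (0 : ℝ) < H := by exact_mod_cast (by lia : 0 < H)
  dsimp only [Function.comp] at hlog
  have htail := roughDensity_mul_le_twinDensity_mul_tailSum (H := H) (by nlinarith : 2 ≤ y)
    (fun p hp => ?_) (fun p hp => by exact_mod_cast (mem_oddPrimesIoc.mp hp).2.le) (by positivity)
    ((div_le_one (by positivity)).mpr (by linarith)) hsum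
  · calc roughDensity y * (H : ℝ) ^ (1 - κ) ≤ roughDensity y * (H / (32 * Real.log H)) := by
          have := roughDensity_nonneg y
          rw [Real.rpow_sub hH0, Real.rpow_one]
          gcongr
      _ = H / 4 * (roughDensity y * (1 / (8 * Real.log H))) := by ring
      _ ≤ H / 4 * (twinDensity y * tailSum H y) := by gcongr
      _ ≤ M H y := mul_twinDensity_mul_tailSum_le_M H y
  · obtain ⟨hpp, hp3, hpH⟩ := mem_oddPrimesLE.mp (mem_oddPrimesIoc.mp hp).1
    exact mem_oddPrimesLE.mpr ⟨hpp, hp3, hpH.trans hHy.le⟩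

theorem eventually_two_mul_rpow_le_card {η : ℝ} (hη0 : 0 < η) (hη1 : η < 1) : ∀ᶠ y : ℕ in atTop,
    2 * (y : ℝ) ^ (1 - η) ≤ #(oddPrimesIoc ((y : ℝ) ^ (1 - η)) y) := by
  have hcast := tendsto_natCast_atTop_atTop (R := ℝ)
  filter_upwards [eventually_ge_atTop 2, eventually_div_log_le_primeCounting,
    hcast.eventually (eventually_mul_log_le_rpow (by norm_num : (0 : ℝ) < 6) hη0),
    ((tendsto_rpow_atTop (sub_pos.mpr hη1)).comp hcast).eventually_ge_atTop 2]
    with y hy hπ hlog hz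
  have hy2 : (2 : ℝ) ≤ y := by exact_mod_cast hy
  have hlog0 : 0 < Real.log y := Real.log_pos (by linarith)
  dsimp only [Function.comp] at hz
  have hmul : (y : ℝ) ^ (1 - η) * (6 * Real.log y) ≤ y :=
    calc (y : ℝ) ^ (1 - η) * (6 * Real.log y) ≤ (y : ℝ) ^ (1 - η) * (y : ℝ) ^ η := by gcongr
      _ = y := by rw [← Real.rpow_add (by positivity), sub_add_cancel, Real.rpow_one]
  have hthree : 3 * (y : ℝ) ^ (1 - η) ≤ y / (2 * Real.log y) := by
    rw [le_div_iff₀ (by positivity)]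
    linarith
  linarith [hπ.trans (primeCounting_le_card_add hz)]

theorem div_pow_le_choose {n K : ℕ} {z L : ℝ} (hz : 0 ≤ z) (hn : 2 * z ≤ n)
    (hKz : K ≤ z) (hKL : K ≤ L) : (z / L) ^ K ≤ n.choose K := by
  have hKn : K ≤ n + 1 := by
    rw [← Nat.cast_le (α := ℝ), Nat.cast_succ]
    linarith
  have hsub : z ≤ ((n + 1 - K : ℕ) : ℝ) := by
    rw [Nat.cast_sub hKn, Nat.cast_succ]
    linarith
  have hfactorial : (K ! : ℝ) ≤ L ^ K :=
    calc (K ! : ℝ) ≤ (K : ℝ) ^ K := by exact_mod_cast Nat.factorial_le_pow K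
      _ ≤ L ^ K := by gcongr
  refine le_trans ?_ (Nat.pow_le_choose (α := ℝ) K n)
  rw [div_pow]
  gcongr

theorem one_div_pow_le_tailSum {H y K : ℕ} {η : ℝ} (hy : 0 < y) (hH : 0 < Real.log H)
    (hcard : 2 * (y : ℝ) ^ (1 - η) ≤ #(oddPrimesIoc ((y : ℝ) ^ (1 - η)) y))
    (hHK : H ≤ ((y : ℝ) ^ (1 - η)) ^ K) (hKy : K ≤ (y : ℝ) ^ (1 - η)) (hKH : K ≤ Real.log H) :
    (1 / ((y : ℝ) ^ η * Real.log H)) ^ K ≤ tailSum H y := by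
  have hy0 : (0 : ℝ) < y := by exact_mod_cast hy
  have hchoose := div_pow_le_choose (by positivity) hcard hKy hKH
  calc (1 / ((y : ℝ) ^ η * Real.log H)) ^ K
      = ((y : ℝ) ^ (1 - η) / Real.log H) ^ K * (1 / (y : ℝ)) ^ K := by
        rw [← mul_pow, Real.rpow_sub hy0, Real.rpow_one]
        field_simp
    _ ≤ _ := mul_le_mul_of_nonneg_right hchoose (by positivity)
    _ ≤ tailSum H y := choose_mul_le_tailSum (by positivity) hHK (filter_subset _ _)
        fun p hp => (mem_oddPrimesIoc.mp hp).2.le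

/-- The exponent `a = log log H / log y`. -/
def logRatio (H y : ℕ) : ℝ := Real.log (Real.log H) / Real.log y

theorem mul_add_le_div_add_mul {K h s u η : ℝ} (hη0 : 0 < η) (hη : η ≤ 1 / 2) (hs : 0 < s)
    (hu : 0 ≤ u) (hus : u ≤ s) (hsh : s ≤ 2 * h) (huh : u ≤ η * h)
    (hK : K ≤ h / ((1 - η) * s) + 1) : K * (η * s + u) ≤ (u / s + 7 * η) * h := by
  have hh : 0 < h := by linarith
  have hη1 : 0 < 1 - η := by linarith
  have hKq : K ≤ (1 + 2 * η) * (h / s) + 1 := by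
    refine hK.trans (add_le_add_left ?_ 1)
    have : 1 / (1 - η) ≤ 1 + 2 * η := by
      rw [div_le_iff₀ hη1]
      nlinarith
    calc h / ((1 - η) * s) = 1 / (1 - η) * (h / s) := by field_simp
      _ ≤ (1 + 2 * η) * (h / s) := by gcongr
  have hqu : h / s * u ≤ h := by
    rw [div_mul_eq_mul_div, div_le_iff₀ hs]
    gcongr
  have hηh : η * (η * h) ≤ 1 / 2 * (η * h) := by gcongr
  calc K * (η * s + u) ≤ ((1 + 2 * η) * (h / s) + 1) * (η * s + u) := by gcongr
    _ = η * h + 2 * (η * (η * h)) + h / s * u + 2 * (η * (h / s * u)) + η * s + u := by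
        field_simp; ring
    _ ≤ η * h + 2 * (1 / 2 * (η * h)) + h / s * u + 2 * (η * h) + η * (2 * h) + η * h := by
        gcongr
    _ = (u / s + 7 * η) * h := by field_simp; ring

theorem rpow_neg_le_tailSum {H y : ℕ} {η : ℝ} (hη0 : 0 < η) (hη : η ≤ 1 / 2)
    (hH : 2 ≤ Real.log H) (hy : 4 ≤ Real.log y) (hyH : y ≤ H ^ 2)
    (hLLy : Real.log (Real.log H) ≤ (1 - η) * Real.log y)
    (hLLH : Real.log (Real.log H) ≤ η * Real.log H)
    (hcard : 2 * (y : ℝ) ^ (1 - η) ≤ #(oddPrimesIoc ((y : ℝ) ^ (1 - η)) y)) :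
    (H : ℝ) ^ (-(logRatio H y + 7 * η)) ≤ tailSum H y := by
  have hpos {n : ℕ} (hn : 2 ≤ Real.log n) : 0 < n :=
    Nat.pos_of_ne_zero fun h => by norm_num [h] at hn
  have hH0 : (0 : ℝ) < H := by exact_mod_cast hpos hH
  have hy0 : (0 : ℝ) < y := by exact_mod_cast hpos (by linarith)
  have hlogyH : Real.log y ≤ 2 * Real.log H := by
    rw [← Nat.cast_ofNat (n := 2), ← Real.log_pow]
    exact Real.log_le_log hy0 (by exact_mod_cast hyH)
  have hηy : 2 ≤ (1 - η) * Real.log y := by nlinarith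
  set K := ⌈Real.log H / ((1 - η) * Real.log y)⌉₊
  have hK : K ≤ Real.log H / ((1 - η) * Real.log y) + 1 :=
    (Nat.ceil_lt_add_one (by positivity)).le
  have hKH : K ≤ Real.log H := by
    have : Real.log H / ((1 - η) * Real.log y) ≤ Real.log H / 2 := by gcongr
    linarith
  have hHK : Real.log H ≤ K * ((1 - η) * Real.log y) :=
    (div_le_iff₀ (by linarith)).mp (Nat.le_ceil _)
  refine le_trans ?_ (one_div_pow_le_tailSum (K := K) (η := η) (hpos (by linarith)) (by linarith)
    hcard ?_ ?_ hKH)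
  · have hexp := mul_add_le_div_add_mul hη0 hη (by linarith) (Real.log_nonneg (by linarith))
      (by nlinarith) hlogyH hLLH hK
    rw [one_div, inv_pow, Real.rpow_neg hH0.le]
    refine inv_anti₀ (by positivity) ?_
    rw [← Real.log_le_log_iff (by positivity) (by positivity), Real.log_pow,
      Real.log_mul (by positivity) (by positivity), Real.log_rpow hy0, Real.log_rpow hH0]
    exact hexp
  · rwa [← Real.log_le_log_iff hH0 (by positivity), Real.log_pow, Real.log_rpow hy0]
  · refine hKH.trans ?_
    rwa [← Real.log_le_log_iff (by linarith) (by positivity), Real.log_rpow hy0]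

variable {ι : Type*} {l : Filter ι} {H y : ι → ℕ}

theorem tendsto_log_natCast {n : ι → ℕ} (hn : Tendsto n l atTop) :
    Tendsto (fun i => Real.log (n i)) l atTop :=
  Real.tendsto_log_atTop.comp (tendsto_natCast_atTop_atTop.comp hn)

theorem eventually_rpow_neg_le_tailSum (hH : Tendsto H l atTop) (hy : Tendsto y l atTop) {ε : ℝ}
    (hε : 0 < ε) (hyH : ∀ᶠ i in l, (1 + ε) * Real.log (Real.log (H i)) ≤ Real.log (y i))
    {κ : ℝ} (hκ : 0 < κ) : ∀ᶠ i in l, y i ≤ H i ^ 2 →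
      (H i : ℝ) ^ (-(logRatio (H i) (y i) + κ)) ≤ tailSum (H i) (y i) := by
  obtain ⟨η, hη0, hη, hηε, hηκ⟩ : ∃ η, 0 < η ∧ η ≤ 1 / 2 ∧ η ≤ ε / (1 + ε) ∧ η ≤ κ / 7 :=
    ⟨min (1 / 2) (min (ε / (1 + ε)) (κ / 7)), by positivity, min_le_left _ _,
      (min_le_right _ _).trans (min_le_left _ _), (min_le_right _ _).trans (min_le_right _ _)⟩
  filter_upwards [hyH, (tendsto_log_natCast hH).eventually_ge_atTop 2,
    (tendsto_log_natCast hH).eventually (eventually_log_le_mul hη0),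
    (tendsto_log_natCast hy).eventually_ge_atTop 4,
    hy.eventually (eventually_two_mul_rpow_le_card hη0 (by linarith)),
    hH.eventually_ge_atTop 1] with i hlogy hlogH hloglog hlogy4 hcard hH1 hyH
  have hLLy : Real.log (Real.log (H i)) ≤ (1 - η) * Real.log (y i) := by
    have hinv : 1 / (1 + ε) ≤ 1 - η := by
      have : 1 - ε / (1 + ε) = 1 / (1 + ε) := by field_simp; ring
      linarith
    calc Real.log (Real.log (H i)) ≤ 1 / (1 + ε) * Real.log (y i) := by
          rwa [one_div_mul_eq_div, le_div_iff₀' (by positivity)]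
      _ ≤ (1 - η) * Real.log (y i) := by gcongr
  refine le_trans (Real.rpow_le_rpow_of_exponent_le (by exact_mod_cast hH1) ?_)
    (rpow_neg_le_tailSum hη0 hη hlogH hlogy4 hyH hLLy hloglog hcard)
  linarith

theorem eventually_rpow_neg_le {κ c : ℝ} (hκ : 0 < κ) (hc : 0 < c) :
    ∀ᶠ n : ℕ in atTop, (n : ℝ) ^ (-κ) ≤ c :=
  ((tendsto_rpow_neg_atTop hκ).comp tendsto_natCast_atTop_atTop).eventually_le_const hc

theorem eventually_le_M (hH : Tendsto H l atTop) (hy : Tendsto y l atTop) {ε : ℝ} (hε : 0 < ε)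
    (hyH : ∀ᶠ i in l, (1 + ε) * Real.log (Real.log (H i)) ≤ Real.log (y i)) {κ : ℝ} (hκ : 0 < κ) :
    ∀ᶠ i in l, roughDensity (y i) * (H i : ℝ) ^ (1 - (logRatio (H i) (y i) + κ)) ≤
      M (H i) (y i) := by
  have hκ3 : 0 < κ / 3 := by positivity
  filter_upwards [hH.eventually (eventually_le_M_of_sq_lt hκ),
    eventually_rpow_neg_le_tailSum hH hy hε hyH hκ3,
    hH.eventually (eventually_rpow_neg_le_twinDensity hκ3),
    hH.eventually (eventually_rpow_neg_le hκ3 (by norm_num : (0 : ℝ) < 1 / 4)),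
    hH.eventually_ge_atTop 1, hy.eventually_ge_atTop 2,
    (tendsto_log_natCast hH).eventually_ge_atTop 1] with i hM htail htwin hquarter hH1 hy2 hlogH
  have hH1' : (1 : ℝ) ≤ H i := by exact_mod_cast hH1
  have hH0 : (0 : ℝ) < H i := by linarith
  have ha : 0 ≤ logRatio (H i) (y i) :=
    div_nonneg (Real.log_nonneg hlogH) (Real.log_natCast_nonneg _)
  rcases lt_or_ge (H i ^ 2) (y i) with hHy | hHy
  · refine le_trans ?_ (hM _ hHy)
    refine mul_le_mul_of_nonneg_left ?_ (roughDensity_nonneg _)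
    exact Real.rpow_le_rpow_of_exponent_le hH1' (by linarith)
  · calc roughDensity (y i) * (H i : ℝ) ^ (1 - (logRatio (H i) (y i) + κ))
        ≤ 1 * (H i : ℝ) ^ (1 - (logRatio (H i) (y i) + κ)) := by
          gcongr
          exact roughDensity_le_one _
      _ = H i * (H i : ℝ) ^ (-(κ / 3)) *
            ((H i : ℝ) ^ (-(κ / 3)) * (H i : ℝ) ^ (-(logRatio (H i) (y i) + κ / 3))) := by
          rw [one_mul, show 1 - (logRatio (H i) (y i) + κ) =
              1 + -(κ / 3) + (-(κ / 3) + -(logRatio (H i) (y i) + κ / 3)) by ring,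
            Real.rpow_add hH0, Real.rpow_add hH0, Real.rpow_add hH0, Real.rpow_one]
      _ ≤ H i * (1 / 4) * (twinDensity (y i) * tailSum (H i) (y i)) := by
          gcongr
          · exact twinDensity_nonneg _
          · exact htwin _ hy2 hHy
          · exact htail hHy
      _ = H i / 4 * (twinDensity (y i) * tailSum (H i) (y i)) := by ring
      _ ≤ M (H i) (y i) := mul_twinDensity_mul_tailSum_le_M _ _

end MainTermAsymptotics

section SieveLevel

theorem exists_even_between {x : ℝ} (hx : 0 < x) :
    ∃ k : ℕ, 0 < k ∧ Even k ∧ x ≤ k ∧ (k : ℝ) ≤ x + 2 := by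
  have hle := Nat.le_ceil (x / 2)
  have hlt := Nat.ceil_lt_add_one (by positivity : 0 ≤ x / 2)
  have hpos : 0 < ⌈x / 2⌉₊ := Nat.ceil_pos.mpr (by positivity)
  refine ⟨2 * ⌈x / 2⌉₊, by lia, even_two_mul _, ?_, ?_⟩
  · push_cast
    linarith
  · push_cast
    linarith

theorem pow_add_le_of_le_mul_div {X y k : ℕ} {δ B : ℝ} (hX : 0 < X) (hy : 2 ≤ y) (hδ : 0 < δ)
    (hδ1 : δ ≤ 1) (hB : B ≤ (1 - δ) * (Real.log X / Real.log y)) (hδB : 44 ≤ δ * B)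
    (hk : k ≤ (1 + δ / 2) * B + 2) : y ^ (k + 20) ≤ X := by
  have hlogy : 0 < Real.log y := Real.log_pos (by exact_mod_cast hy)
  have : 0 < y := by lia
  have hku : ((k + 20 : ℕ) : ℝ) ≤ Real.log X / Real.log y := by
    push_cast
    nlinarith
  rw [le_div_iff₀ hlogy, ← Real.log_pow, Real.log_le_log_iff (by positivity) (by positivity)] at hku
  exact_mod_cast hku

theorem sieveSaving_le_rpow {H k : ℕ} {a δ : ℝ} (hδ0 : 0 ≤ δ) (hδ : δ ≤ 1 / 2) (ha : 0 ≤ a)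
    (hH : 0 < H) (hLL : 0 < Real.log (Real.log H))
    (hloglog : Real.log (Real.log (Real.log H)) ≤ δ / 16 * Real.log (Real.log H))
    (hlogH : 0 < Real.log H)
    (hk : (1 + δ / 2) * ((1 + a) * (Real.log H / Real.log (Real.log H))) ≤ k)
    (hs : sieveSaving k ≤ Real.exp (-((1 - δ / 16) * (k * Real.log k)))) :
    sieveSaving k ≤ (H : ℝ) ^ (-(1 + a + δ / 4)) := by
  set L := Real.log H
  set LL := Real.log L
  have hLk : L / LL ≤ k := by
    have h1 : 1 ≤ (1 + δ / 2) * (1 + a) := by nlinarith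
    exact (le_mul_of_one_le_left (by positivity) h1).trans (by linarith)
  have hlogk : (1 - δ / 16) * LL ≤ Real.log k := by
    refine le_trans ?_ (Real.log_le_log (by positivity) hLk)
    rw [Real.log_div hlogH.ne' hLL.ne']
    linarith
  have hδ16 : 0 ≤ 1 - δ / 16 := by linarith
  have hδ4 : 1 + δ / 4 ≤ (1 - δ / 16) * (1 - δ / 16) * (1 + δ / 2) := by
    nlinarith [mul_nonneg hδ0 (sub_nonneg.mpr hδ), pow_nonneg hδ0 3]
  rw [Real.rpow_def_of_pos (by exact_mod_cast hH)]
  refine hs.trans (Real.exp_le_exp.mpr ?_)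
  rw [mul_neg, neg_le_neg_iff]
  calc L * (1 + a + δ / 4) ≤ L * ((1 + δ / 4) * (1 + a)) := by
        gcongr
        nlinarith
    _ ≤ L * ((1 - δ / 16) * (1 - δ / 16) * (1 + δ / 2) * (1 + a)) := by gcongr
    _ = (1 - δ / 16) * ((1 + δ / 2) * ((1 + a) * (L / LL)) * ((1 - δ / 16) * LL)) := by
        field_simp
    _ ≤ (1 - δ / 16) * (k * Real.log k) := by gcongr

theorem tendsto_div_log_atTop : Tendsto (fun t : ℝ => t / Real.log t) atTop atTop := by
  have hzero : Tendsto (fun t : ℝ => Real.log t / t) atTop (nhdsWithin 0 (Set.Ioi 0)) := by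
    refine tendsto_nhdsWithin_iff.mpr ⟨Real.isLittleO_log_id_atTop.tendsto_div_nhds_zero, ?_⟩
    filter_upwards [eventually_gt_atTop 1] with t ht
    exact div_pos (Real.log_pos ht) (by linarith)
  exact (tendsto_inv_nhdsGT_zero.comp hzero).congr fun t => inv_div _ _

variable {ι : Type*} {l : Filter ι} {X H y : ι → ℕ}

theorem eventually_exists_sieve_level (hX : Tendsto X l atTop) (hH : Tendsto H l atTop)
    (hy : Tendsto y l atTop)
    (hLLy : ∀ᶠ i in l, Real.log (Real.log (H i)) ≤ Real.log (y i))
    {δ : ℝ} (hδ0 : 0 < δ) (hδ : δ ≤ 1 / 2)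
    (hsieve : ∀ᶠ i in l, (1 + logRatio (H i) (y i)) *
      (Real.log (H i) / Real.log (Real.log (H i))) ≤
        (1 - δ) * (Real.log (X i) / Real.log (y i))) :
    ∀ᶠ i in l, ∃ k, 0 < k ∧ Even k ∧ k + 1 ≤ 2 * y i ∧ y i ^ (k + 20) ≤ X i ∧
      sieveSaving k ≤ (H i : ℝ) ^ (-(1 + logRatio (H i) (y i) + δ / 4)) := by
  have hlogH := tendsto_log_natCast hH
  have hLL := Real.tendsto_log_atTop.comp hlogH
  have hL := tendsto_div_log_atTop.comp hlogH
  obtain ⟨k₀, hk₀⟩ := eventually_atTop.mp (eventually_sieveSaving_le (by positivity : 0 < δ / 16))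
  filter_upwards [hsieve, hLLy, hX.eventually_gt_atTop 0, hH.eventually_gt_atTop 0,
    hy.eventually_ge_atTop 2, hlogH.eventually_gt_atTop 0, hLL.eventually_ge_atTop 8,
    hL.eventually_ge_atTop (60 / δ), hL.eventually_ge_atTop (k₀ : ℝ),
    hLL.eventually (eventually_log_le_mul (by positivity : 0 < δ / 16))]
    with i hsieve hLLy hX hH hy hlogH hLL hL60 hLk₀ hloglog
  dsimp only [Function.comp] at hLL hL60 hLk₀ hloglog
  have ha0 : 0 ≤ logRatio (H i) (y i) := div_nonneg (by linarith) (Real.log_natCast_nonneg _)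
  have ha1 : logRatio (H i) (y i) ≤ 1 := (div_le_one (by linarith)).mpr hLLy
  have hlogHy : Real.log (H i) ≤ y i :=
    (Real.log_le_log_iff hlogH (by positivity)).mp hLLy
  have hL8 : Real.log (H i) / Real.log (Real.log (H i)) ≤ y i / 8 := by gcongr
  set L := Real.log (H i) / Real.log (Real.log (H i))
  set a := logRatio (H i) (y i)
  have hLδ : 60 ≤ L * δ := (div_le_iff₀ hδ0).mp hL60
  have hL0 : 0 < L := by nlinarith
  have hLB : L ≤ (1 + a) * L := le_mul_of_one_le_left hL0.le (by linarith)
  have hB2L : (1 + a) * L ≤ 2 * L := by gcongr; linarith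
  obtain ⟨k, hk0, hk, hBk, hkB⟩ := exists_even_between
    (by positivity : 0 < (1 + δ / 2) * ((1 + a) * L))
  have hBk' : (1 + a) * L ≤ k := by nlinarith
  refine ⟨k, hk0, hk, ?_, pow_add_le_of_le_mul_div hX hy hδ0 (by linarith) hsieve
    (by nlinarith) hkB, sieveSaving_le_rpow hδ0.le hδ ha0 hH (by linarith) hloglog hlogH hBk
    (hk₀ k (by exact_mod_cast hLk₀.trans (hLB.trans hBk')))⟩
  have : (k + 1 : ℝ) ≤ 2 * y i := by nlinarith
  exact_mod_cast this

theorem eventually_abs_V_sub_M_le (hX : Tendsto X l atTop) (hH : Tendsto H l atTop)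
    (hy : Tendsto y l atTop)
    (hLLy : ∀ᶠ i in l, Real.log (Real.log (H i)) ≤ Real.log (y i))
    {δ : ℝ} (hδ0 : 0 < δ) (hδ : δ ≤ 1 / 2)
    (hsieve : ∀ᶠ i in l, (1 + logRatio (H i) (y i)) *
      (Real.log (H i) / Real.log (Real.log (H i))) ≤
        (1 - δ) * (Real.log (X i) / Real.log (y i))) :
    ∀ᶠ i in l, |V (X i) (H i) (y i) - M (H i) (y i)| ≤
      12 * (roughDensity (y i) * (H i : ℝ) ^ (1 - (logRatio (H i) (y i) + δ / 4))) := by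
  filter_upwards [eventually_exists_sieve_level hX hH hy hLLy hδ0 hδ hsieve,
    hX.eventually_gt_atTop 0, hH.eventually_ge_atTop 1, hy.eventually_ge_atTop 2,
    (tendsto_log_natCast hH).eventually_ge_atTop 1]
    with i ⟨k, hk0, hk, hky, hkX, hs⟩ hX hH hy hlogH
  have hH1 : (1 : ℝ) ≤ H i := by exact_mod_cast hH
  have hH0 : (0 : ℝ) < H i := by linarith
  have ha : 0 ≤ logRatio (H i) (y i) :=
    div_nonneg (Real.log_nonneg hlogH) (Real.log_natCast_nonneg _)
  have hs1 : sieveSaving k ≤ 1 := hs.trans (Real.rpow_le_one_of_one_le_of_nonpos hH1 (by linarith))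
  have hP := roughDensity_nonneg (y i)
  calc |V (X i) (H i) (y i) - M (H i) (y i)|
      ≤ 3 * (H i : ℝ) ^ 2 * (4 * (roughDensity (y i) * sieveSaving k)) :=
        abs_V_sub_M_le hX hy _ (abs_pairCount_div_sub_le hk0 hk hy hky hkX hs1)
    _ ≤ 3 * (H i : ℝ) ^ 2 * (4 * (roughDensity (y i) *
          (H i : ℝ) ^ (-(1 + logRatio (H i) (y i) + δ / 4)))) := by gcongr
    _ = 12 * (roughDensity (y i) * ((H i : ℝ) ^ 2 *
          (H i : ℝ) ^ (-(1 + logRatio (H i) (y i) + δ / 4)))) := by ring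
    _ = 12 * (roughDensity (y i) * (H i : ℝ) ^ (1 - (logRatio (H i) (y i) + δ / 4))) := by
        rw [← Real.rpow_natCast, ← Real.rpow_add hH0]
        congr 3
        push_cast
        ring

theorem isEquivalent_of_abs_sub_le_rpow (hH : Tendsto H l atTop) {u v P a : ι → ℝ} {C κ : ℝ}
    (hC : 0 < C) (hκ : 0 < κ) (hP : ∀ i, 0 ≤ P i)
    (huv : ∀ᶠ i in l, |u i - v i| ≤ C * (P i * (H i : ℝ) ^ (1 - (a i + 2 * κ))))
    (hv : ∀ᶠ i in l, P i * (H i : ℝ) ^ (1 - (a i + κ)) ≤ v i) : u ~[l] v := by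
  refine IsLittleO.of_bound fun c hc => ?_
  filter_upwards [huv, hv, hH.eventually_gt_atTop 0,
    hH.eventually (eventually_rpow_neg_le hκ (by positivity : 0 < c / C))] with i huv hv hH hdecay
  calc |u i - v i| ≤ C * (P i * (H i : ℝ) ^ (1 - (a i + 2 * κ))) := huv
    _ = C * (H i : ℝ) ^ (-κ) * (P i * (H i : ℝ) ^ (1 - (a i + κ))) := by
        rw [show 1 - (a i + 2 * κ) = -κ + (1 - (a i + κ)) by ring,
          Real.rpow_add (by exact_mod_cast hH)]
        ring
    _ ≤ c * |v i| := by
        have := hP i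
        gcongr
        · rwa [← le_div_iff₀' hC]
        · exact hv.trans (le_abs_self _)

end SieveLevel

end RoughVariance

end

theorem theorem1 {ι : Type*} (l : Filter ι) (X H y : ι → ℕ) (ε δ : ℝ)
    (hε : 0 < ε) (hδ : 0 < δ)
    (hX : Tendsto X l atTop) (hH : Tendsto H l atTop) (hy : Tendsto y l atTop)
    (hyX : ∀ᶠ i in l, y i ≤ X i) (hHX : ∀ᶠ i in l, H i ≤ X i)
    (hyH : ∀ᶠ i in l, Real.log (H i) ^ (1 + ε) ≤ (y i : ℝ))
    (hsieve : ∀ᶠ i in l,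
      (1 + Real.log (Real.log (H i)) / Real.log (y i)) *
          (Real.log (H i) / Real.log (Real.log (H i))) ≤
        (1 - δ) * (Real.log (X i) / Real.log (y i))) :
    (fun i => RoughVariance.V (X i) (H i) (y i)) ~[l]
      (fun i => RoughVariance.M (H i) (y i)) := by
  have hlogH := RoughVariance.tendsto_log_natCast hH
  have hlogy : ∀ᶠ i in l, (1 + ε) * Real.log (Real.log (H i)) ≤ Real.log (y i) := by
    filter_upwards [hyH, hlogH.eventually_gt_atTop 0] with i hyH hlogH
    rw [← Real.log_rpow hlogH]
    exact Real.log_le_log (Real.rpow_pos_of_pos hlogH _) hyH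
  have hLLy : ∀ᶠ i in l, Real.log (Real.log (H i)) ≤ Real.log (y i) := by
    filter_upwards [hlogy, hlogH.eventually_ge_atTop 1] with i hlogy hlogH
    nlinarith [Real.log_nonneg hlogH]
  have hδ₁ : 0 < min δ (1 / 2) := by positivity
  have hsieve₁ : ∀ᶠ i in l, (1 + RoughVariance.logRatio (H i) (y i)) *
      (Real.log (H i) / Real.log (Real.log (H i))) ≤
        (1 - min δ (1 / 2)) * (Real.log (X i) / Real.log (y i)) := by
    filter_upwards [hsieve] with i hsieve
    refine hsieve.trans (mul_le_mul_of_nonneg_right (by linarith [min_le_left δ (1 / 2)]) ?_)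
    exact div_nonneg (Real.log_natCast_nonneg _) (Real.log_natCast_nonneg _)
  refine RoughVariance.isEquivalent_of_abs_sub_le_rpow hH (by norm_num : (0 : ℝ) < 12)
    (by positivity : 0 < min δ (1 / 2) / 8) (fun i => RoughVariance.roughDensity_nonneg (y i)) ?_
    (RoughVariance.eventually_le_M hH hy hε hlogy (by positivity))
  convert RoughVariance.eventually_abs_V_sub_M_le hX hH hy hLLy hδ₁ (min_le_right _ _) hsieve₁
    using 8
  ring
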